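/- Let $C$ be the space of continuous $2\pi$-periodic functions $f:\mathbb R\to\mathbb R$ with the uniform norm $\|\cdot\|$. For $n,r\in\mathbb N=\{1,2,\dots\}$ let $E_{n-1}(f)=\inf_\tau\|f-\tau\|$ be the value of best approximation of $f$ by trigonometric polynomials $\tau$ of degree at most $n-1$, and let $$\omega_r(f,\delta)=\sup_{0<h\le\delta}\Big\|\sum_{i=0}^r(-1)^i\binom ri f(\cdot+ih)\Big\|$$ be the $r$-th modulus of smoothness. Put $$K_{n,r}(\delta)=\sup_{f\in C}\frac{E_{n-1}(f)}{\omega_r(f,\delta)},\qquad \gamma_r^*=\binom{r}{\lfloor r/2\rfloor}^{-1},$$ where $0/0=0$ and $a/0=+\infty$ for $a>0$, and let $c'_r=1$ if $r$ is even, $c'_r=1-\frac1{r+1}$ if $r$ is odd. Let $s_i(f)$ denote the Fourier sum of $f$ of degree $i$, and for $0\le m<n$ let $v_{m,n}(f)=\frac1{n-m}\sum_{i=m}^{n-1}s_i(f)$ be the de la Vallée Poussin sum. Then for every $r\ge1$: (a) $K_{n,r}\big(\tfrac{2\pi}n\big)\le 5\,\gamma_r^*$ for all $n\ge1$. (b)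 For all $n\ge1$ and $f\in C$, with $m=\lfloor\frac89n\rfloor$ (the same for all $r$), $v_{m,n}(f)$ is a trigonometric polynomial of degree at most $n-1$ and $$\|f-v_{m,n}(f)\|\le 5\,\gamma_r^*\,\omega_r\big(f,\tfrac{2\pi}n\big).$$ (c) $K_{n,r}(\delta)\ge c'_r\,\gamma_r^*$ for all $n\ge1$ and all $0\le\delta\le\frac{\pi}{r}$. In particular, $K_{n,r}\big(\tfrac{2\pi}n\big)\ge c'_r\,\gamma_r^*$ for all $n\ge 2r$. -/

import Mathlib

open scoped ENNReal

noncomputable section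

/-- `C`: the continuous real functions on the line that are `2π`-periodic. -/
def periodicC : Set (ℝ → ℝ) :=
  {f | Continuous f ∧ Function.Periodic f (2 * Real.pi)}

/-- The uniform norm `‖g‖ = sup_x |g x|`, with values in `[0, ∞]`
(finite for every bounded function, in particular on `periodicC`). -/
def supNorm (g : ℝ → ℝ) : ℝ≥0∞ := ⨆ x : ℝ, ‖g x‖ₑ

/-- `T_d`: the real trigonometric polynomials of degree at most `d`. -/
def trigPoly (d : ℕ) : Set (ℝ → ℝ) :=
  {τ | ∃ a b : ℕ → ℝ, ∀ x : ℝ,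
    τ x = ∑ k ∈ Finset.range (d + 1), (a k * Real.cos (k * x) + b k * Real.sin (k * x))}

/-- `E_d(f)`: the value of best uniform approximation of `f` by trigonometric polynomials
of degree at most `d`. -/
def bestApprox (d : ℕ) (f : ℝ → ℝ) : ℝ≥0∞ :=
  ⨅ τ ∈ trigPoly d, supNorm (fun x => f x - τ x)

/-- The difference `Δ_h^r(f, x) = ∑_{i=0}^r (-1)^i (r choose i) f(x + i h)`. -/
def forwardDiff (r : ℕ) (h : ℝ) (f : ℝ → ℝ) (x : ℝ) : ℝ :=
  ∑ i ∈ Finset.range (r + 1), (-1 : ℝ) ^ i * (r.choose i : ℝ) * f (x + i * h)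

/-- `ω_r(f, δ) = sup_{0 < h ≤ δ} ‖Δ_h^r(f, ·)‖`: the `r`-th modulus of smoothness. -/
def modulus (r : ℕ) (f : ℝ → ℝ) (δ : ℝ) : ℝ≥0∞ :=
  ⨆ h ∈ Set.Ioc (0 : ℝ) δ, supNorm (forwardDiff r h f)

/-- `K_{n,r}(δ) = sup_{f ∈ C} E_{n-1}(f) / ω_r(f, δ)` (used for `n ≥ 1`), i.e. the least
`K ∈ [0, ∞]` with `E_{n-1}(f) ≤ K ω_r(f, δ)` for all `f ∈ C`. The quotient is taken in
`[0, ∞]`, where `a / 0 = ∞` for `a > 0` and `0 / 0 = 0`; numerator and denominator are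
finite for `f ∈ C`. -/
def stechkinConst (n r : ℕ) (δ : ℝ) : ℝ≥0∞ :=
  ⨆ f ∈ periodicC, bestApprox (n - 1) f / modulus r f δ

/-- `γ_r^* = 1 / (r choose ⌊r/2⌋)`. -/
def gammaStar (r : ℕ) : ℝ := 1 / (r.choose (r / 2) : ℝ)

/-- `c'_r = 1` for even `r`, and `1 - 1/(r+1)` for odd `r`. -/
def lowerConst (r : ℕ) : ℝ := if Even r then 1 else 1 - 1 / ((r : ℝ) + 1)

/-- Cosine Fourier coefficient `a_k(f) = (1/π) ∫_{-π}^{π} f(t) cos(kt) dt`. -/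
def cosCoeff (f : ℝ → ℝ) (k : ℕ) : ℝ :=
  (1 / Real.pi) * ∫ t in (-Real.pi)..Real.pi, f t * Real.cos (k * t)

/-- Sine Fourier coefficient `b_k(f) = (1/π) ∫_{-π}^{π} f(t) sin(kt) dt`. -/
def sinCoeff (f : ℝ → ℝ) (k : ℕ) : ℝ :=
  (1 / Real.pi) * ∫ t in (-Real.pi)..Real.pi, f t * Real.sin (k * t)

/-- The Fourier sum `s_i(f)` of degree `i`. -/
def fourierSum (i : ℕ) (f : ℝ → ℝ) (x : ℝ) : ℝ :=
  cosCoeff f 0 / 2 +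
    ∑ k ∈ Finset.Icc 1 i,
      (cosCoeff f k * Real.cos (k * x) + sinCoeff f k * Real.sin (k * x))

/-- The de la Vallée Poussin sum `v_{m,n}(f) = (1/(n-m)) ∑_{i=m}^{n-1} s_i(f)`,
for `0 ≤ m < n`. -/
def valleePoussin (m n : ℕ) (f : ℝ → ℝ) (x : ℝ) : ℝ :=
  (1 / ((n : ℝ) - (m : ℝ))) * ∑ i ∈ Finset.Ico m n, fourierSum i f x

end

noncomputable section

open Real intervalIntegral

/-! Upper bound. Let `κ` be a natural number, `h = 2π/n`, and divide the centred difference of order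
`2κ` with step `t` by its middle coefficient, so that it becomes `f` minus a combination of
symmetric translates. Averaging over `0 ≤ t ≤ h` with the weight `(2/h)(1 - t/h)` gives a Fourier
multiplier `w = avgDiffCoeff` satisfying `w_k = 1 - q_k D_k`, where `q_k = (n/2k)²` and `D =
shiftCoeff` is again a combination of translations (`avgDiffCoeff_eq`). The average is bounded by `T
= ω/(2κ choose κ)`, `ω` being a bound for the differences, and `D` has norm at most about `1`
uniformly in `κ`, because its coefficients are controlled by `2 ∑ 1/j²` over odd `j`, which is
`π²/4`.

Let `v` be the de la Vallée Poussin multiplier. Using `1 = w + qD` twice gives `1 - v = w - v w + (1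
- v) q D w + q² D² (1 - v)` (`one_sub_valleeCoeff_eq`). The last term contains `1 - v` again, which
lives on frequencies `k > m ≈ 8n/9`, where `q²` has a small norm as a multiplier. Hence `‖f - v f‖`
can be absorbed on the left. The norms of `v`, `(1 - v) q` and `q²` come from a Carlson type
inequality for the `L¹` norm of a kernel in terms of its coefficients and their differences
(`integral_abs_cosKernel_le`). The argument is run for trigonometric polynomials
(`abs_sub_valleePoussin_trigSum_le`) and extended by density. Odd `r` follows from `r + 1` without
loss, since `|Δ^{r+1}| ≤ 2 sup |Δ^r|` and `γ_r^* = 2 γ_{r+1}^*`.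

Lower bound. A smoothed square wave has variation `2` on an interval of length `π`. If `r h ≤ π`,
its `r`-th difference combines consecutive increments on such an interval with coefficients at most
`(r-1 choose ⌊(r-1)/2⌋)`, so `ω_r` is at most twice this number. Being odd with a steep jump at `0`,
it stays at distance nearly `1` from polynomials of a fixed degree. -/

/-! ### Orthogonality relations and the `L¹` norm of even kernels -/

lemma integral_cos_intCast (z : ℤ) :
    ∫ t in (-π)..π, cos (z * t) = if z = 0 then 2 * π else 0 := by
  split_ifs with h
  · subst h
    simp
    ring
  · have hz : (z : ℝ) ≠ 0 := by exact_mod_cast h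
    rw [intervalIntegral.integral_comp_mul_left (fun x => cos x) hz, integral_cos]
    have h1 : sin (z * π) = 0 := Real.sin_int_mul_pi z
    simp [h1]

lemma integral_sin_intCast (z : ℤ) : ∫ t in (-π)..π, sin (z * t) = 0 := by
  by_cases h : z = 0
  · subst h
    simp
  · have hz : (z : ℝ) ≠ 0 := by exact_mod_cast h
    rw [intervalIntegral.integral_comp_mul_left (fun x => sin x) hz, integral_sin]
    simp

lemma integral_cos_mul_cos_natCast (k l : ℕ) :
    ∫ t in (-π)..π, cos (k * t) * cos (l * t) =
      if k = l then (if k = 0 then 2 * π else π) else 0 := by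
  have h : ∀ t : ℝ, cos (k * t) * cos (l * t) =
      2⁻¹ * (cos (((k : ℤ) - l : ℤ) * t) + cos (((k : ℤ) + l : ℤ) * t)) := by
    intro t
    push_cast
    rw [sub_mul, add_mul, cos_sub, cos_add]
    ring
  simp_rw [h]
  rw [intervalIntegral.integral_const_mul, intervalIntegral.integral_add
    (by apply Continuous.intervalIntegrable; fun_prop)
    (by apply Continuous.intervalIntegrable; fun_prop), integral_cos_intCast, integral_cos_intCast]
  split_ifs <;> first | omega | ring

lemma integral_sin_mul_sin_natCast (k l : ℕ) :
    ∫ t in (-π)..π, sin (k * t) * sin (l * t) =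
      if k = l then (if k = 0 then 0 else π) else 0 := by
  have h : ∀ t : ℝ, sin (k * t) * sin (l * t) =
      2⁻¹ * (cos (((k : ℤ) - l : ℤ) * t) - cos (((k : ℤ) + l : ℤ) * t)) := by
    intro t
    push_cast
    rw [sub_mul, add_mul, cos_sub, cos_add]
    ring
  simp_rw [h]
  rw [intervalIntegral.integral_const_mul, intervalIntegral.integral_sub
    (by apply Continuous.intervalIntegrable; fun_prop)
    (by apply Continuous.intervalIntegrable; fun_prop), integral_cos_intCast, integral_cos_intCast]
  split_ifs <;> first | omega | ring

lemma integral_cos_mul_sin_natCast (k l : ℕ) :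
    ∫ t in (-π)..π, cos (k * t) * sin (l * t) = 0 := by
  have h : ∀ t : ℝ, cos (k * t) * sin (l * t) =
      2⁻¹ * (sin (((l : ℤ) - k : ℤ) * t) + sin (((k : ℤ) + l : ℤ) * t)) := by
    intro t
    push_cast
    rw [sub_mul, add_mul, sin_sub, sin_add]
    ring
  simp_rw [h]
  rw [intervalIntegral.integral_const_mul, intervalIntegral.integral_add
    (by apply Continuous.intervalIntegrable; fun_prop)
    (by apply Continuous.intervalIntegrable; fun_prop), integral_sin_intCast, integral_sin_intCast]
  simp

lemma integral_sin_half_mul_sin_half (k l : ℕ) :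
    ∫ t in (-π)..π, sin ((k + 1 / 2) * t) * sin ((l + 1 / 2) * t) = if k = l then π else 0 := by
  have h : ∀ t : ℝ, sin ((k + 1 / 2) * t) * sin ((l + 1 / 2) * t) =
      2⁻¹ * (cos (((k : ℤ) - l : ℤ) * t) - cos (((k : ℤ) + l + 1 : ℤ) * t)) := by
    intro t
    push_cast
    have e1 : ((k : ℝ) - l) * t = (k + 1 / 2) * t - (l + 1 / 2) * t := by ring
    have e2 : ((k : ℝ) + l + 1) * t = (k + 1 / 2) * t + (l + 1 / 2) * t := by ring
    rw [e1, e2, cos_sub, cos_add]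
    ring
  simp_rw [h]
  rw [intervalIntegral.integral_const_mul, intervalIntegral.integral_sub
    (by apply Continuous.intervalIntegrable; fun_prop)
    (by apply Continuous.intervalIntegrable; fun_prop), integral_cos_intCast, integral_cos_intCast]
  split_ifs <;> first | omega | ring

/-- The even trigonometric kernel `c₀ + 2 ∑_{k=1}^N c_k cos kt`. -/
def cosKernel (N : ℕ) (c : ℕ → ℝ) (t : ℝ) : ℝ :=
  c 0 + 2 * ∑ k ∈ Finset.range N, c (k + 1) * cos ((k + 1 : ℕ) * t)

lemma continuous_cosKernel (N : ℕ) (c : ℕ → ℝ) : Continuous (cosKernel N c) := by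
  unfold cosKernel
  fun_prop

lemma integral_cosKernel_mul_cos (N : ℕ) (c : ℕ → ℝ) (l : ℕ) :
    ∫ t in (-π)..π, cosKernel N c t * cos (l * t) = if l ≤ N then 2 * π * c l else 0 := by
  have h : ∀ t : ℝ, cosKernel N c t * cos (l * t) = c 0 * cos (((l : ℤ) : ℝ) * t) +
      ∑ k ∈ Finset.range N, 2 * c (k + 1) * (cos ((k + 1 : ℕ) * t) * cos (l * t)) := by
    intro t
    simp only [cosKernel, add_mul, mul_assoc, Finset.mul_sum, Finset.sum_mul, Int.cast_natCast]
  simp_rw [h]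
  rw [intervalIntegral.integral_add (by apply Continuous.intervalIntegrable; fun_prop)
    (by apply Continuous.intervalIntegrable; fun_prop),
    intervalIntegral.integral_finsetSum
      (fun i _ => by apply Continuous.intervalIntegrable; fun_prop)]
  simp_rw [intervalIntegral.integral_const_mul, integral_cos_mul_cos_natCast, integral_cos_intCast]
  rcases l with _ | l
  · simp
    ring
  · simp only [Nat.add_right_cancel_iff, Nat.succ_ne_zero, if_false, mul_ite, mul_zero,
      Finset.sum_ite_eq', Finset.mem_range, Nat.succ_le_iff]
    split_ifs with h1 h2 <;> first | omega | ring

lemma integral_cosKernel_mul_sin (N : ℕ) (c : ℕ → ℝ) (l : ℕ) :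
    ∫ t in (-π)..π, cosKernel N c t * sin (l * t) = 0 := by
  have h : ∀ t : ℝ, cosKernel N c t * sin (l * t) = c 0 * sin (((l : ℤ) : ℝ) * t) +
      ∑ k ∈ Finset.range N, 2 * c (k + 1) * (cos ((k + 1 : ℕ) * t) * sin (l * t)) := by
    intro t
    simp only [cosKernel, add_mul, mul_assoc, Finset.mul_sum, Finset.sum_mul, Int.cast_natCast]
  simp_rw [h]
  rw [intervalIntegral.integral_add (by apply Continuous.intervalIntegrable; fun_prop)
    (by apply Continuous.intervalIntegrable; fun_prop),
    intervalIntegral.integral_finsetSum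
      (fun i _ => by apply Continuous.intervalIntegrable; fun_prop)]
  simp_rw [intervalIntegral.integral_const_mul, integral_cos_mul_sin_natCast, integral_sin_intCast]
  simp

lemma integral_cosKernel_sq (N : ℕ) (c : ℕ → ℝ) :
    ∫ t in (-π)..π, cosKernel N c t ^ 2 =
      2 * π * (c 0 ^ 2 + 2 * ∑ k ∈ Finset.range N, c (k + 1) ^ 2) := by
  have h : ∀ t : ℝ, cosKernel N c t ^ 2 = c 0 * (cosKernel N c t * cos ((0 : ℕ) * t)) +
      ∑ k ∈ Finset.range N, 2 * c (k + 1) * (cosKernel N c t * cos ((k + 1 : ℕ) * t)) := by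
    intro t
    rw [sq]
    nth_rewrite 2 [cosKernel]
    rw [mul_add, mul_left_comm, Finset.mul_sum, Finset.mul_sum]
    congr 1
    · simp [mul_comm]
    · exact Finset.sum_congr rfl fun _ _ => by ring
  have hc := continuous_cosKernel N c
  simp_rw [h]
  rw [intervalIntegral.integral_add (by apply Continuous.intervalIntegrable; fun_prop)
    (by apply Continuous.intervalIntegrable; fun_prop),
    intervalIntegral.integral_finsetSum
      (fun i _ => by apply Continuous.intervalIntegrable; fun_prop)]
  simp_rw [intervalIntegral.integral_const_mul, integral_cosKernel_mul_cos]
  rw [if_pos (Nat.zero_le _), mul_add, mul_left_comm (2 * π) 2, Finset.mul_sum, Finset.mul_sum]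
  congr 1
  · ring
  · refine Finset.sum_congr rfl fun k hk => ?_
    rw [if_pos (by simpa [Nat.succ_le_iff] using hk)]
    ring

/-- Abel summation, from `2 sin(t/2) cos kt = sin((k+1/2)t) - sin((k-1/2)t)`. Since half-integer
sines are orthogonal, this turns a weighted `L²` norm of the kernel into a sum of squared
coefficient differences. -/
lemma two_sin_half_mul_cosKernel (N : ℕ) (c : ℕ → ℝ) (t : ℝ) :
    2 * sin (t / 2) * cosKernel N c t =
      2 * (∑ k ∈ Finset.range N, (c k - c (k + 1)) * sin ((k + 1 / 2) * t) +
        c N * sin ((N + 1 / 2) * t)) := by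
  induction N with
  | zero => simp [cosKernel]; ring_nf
  | succ N ih =>
    have h1 : cosKernel (N + 1) c t =
        cosKernel N c t + 2 * (c (N + 1) * cos ((N + 1 : ℕ) * t)) := by
      simp only [cosKernel, Finset.sum_range_succ]
      ring
    rw [h1, mul_add, ih, Finset.sum_range_succ]
    have e1 : ((N + 1 : ℕ) + 1 / 2 : ℝ) * t = (N + 1 : ℕ) * t + t / 2 := by ring
    have e2 : ((N : ℝ) + 1 / 2) * t = (N + 1 : ℕ) * t - t / 2 := by push_cast; ring
    rw [e1, e2, sin_add, sin_sub]
    ring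

lemma integral_sum_sin_half_sq (L : ℕ) (g : ℕ → ℝ) :
    ∫ t in (-π)..π, (∑ k ∈ Finset.range L, g k * sin ((k + 1 / 2) * t)) ^ 2 =
      π * ∑ k ∈ Finset.range L, g k ^ 2 := by
  have h : ∀ t : ℝ, (∑ k ∈ Finset.range L, g k * sin ((k + 1 / 2) * t)) ^ 2 =
      ∑ k ∈ Finset.range L, ∑ l ∈ Finset.range L,
        g k * g l * (sin ((k + 1 / 2) * t) * sin ((l + 1 / 2) * t)) := by
    intro t
    rw [sq, Finset.sum_mul_sum]
    exact Finset.sum_congr rfl fun _ _ => Finset.sum_congr rfl fun _ _ => by ring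
  simp_rw [h]
  rw [intervalIntegral.integral_finsetSum
      (fun i _ => by apply Continuous.intervalIntegrable; fun_prop), Finset.mul_sum]
  refine Finset.sum_congr rfl fun k hk => ?_
  rw [intervalIntegral.integral_finsetSum
      (fun i _ => by apply Continuous.intervalIntegrable; fun_prop)]
  simp_rw [intervalIntegral.integral_const_mul, integral_sin_half_mul_sin_half]
  simp only [mul_ite, mul_zero, Finset.sum_ite_eq, hk, if_true]
  ring

lemma integral_two_sin_half_mul_cosKernel_sq (N : ℕ) (c : ℕ → ℝ) :
    ∫ t in (-π)..π, (2 * sin (t / 2) * cosKernel N c t) ^ 2 =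
      2 * π * (2 * (∑ k ∈ Finset.range N, (c k - c (k + 1)) ^ 2 + c N ^ 2)) := by
  -- Cutting the kernel at `N` makes the last difference the full jump `c N - 0`.
  set g : ℕ → ℝ := fun k => if k < N then c k - c (k + 1) else c N with hg
  have hsum : ∀ F : ℝ → ℕ → ℝ, ∑ k ∈ Finset.range (N + 1), F (g k) k =
      ∑ k ∈ Finset.range N, F (c k - c (k + 1)) k + F (c N) N := by
    intro F
    rw [Finset.sum_range_succ]
    congr 1
    · exact Finset.sum_congr rfl fun k hk => by simp [hg, Finset.mem_range.1 hk]
    · simp [hg]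
  have h : ∀ t : ℝ, (2 * sin (t / 2) * cosKernel N c t) ^ 2 =
      4 * (∑ k ∈ Finset.range (N + 1), g k * sin ((k + 1 / 2) * t)) ^ 2 := by
    intro t
    rw [two_sin_half_mul_cosKernel, hsum (fun y k => y * sin ((k + 1 / 2) * t))]
    ring
  simp_rw [h]
  rw [intervalIntegral.integral_const_mul, integral_sum_sin_half_sq, hsum (fun y _ => y ^ 2)]
  ring

lemma integral_inv_add_sin_sq {A B : ℝ} (hA : 0 < A) (hB : 0 < B) :
    ∫ t in (-π)..π, (A + 4 * B * sin (t / 2) ^ 2)⁻¹ = 2 * π / √(A * (A + 4 * B)) := by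
  set s := √((A + 4 * B) / A) with hs
  have hq : 0 < (A + 4 * B) / A := by positivity
  have hs0 : 0 < s := Real.sqrt_pos.2 hq
  have hs2 : s ^ 2 = (A + 4 * B) / A := Real.sq_sqrt hq.le
  have hAs : √(A * (A + 4 * B)) = A * s := by
    rw [Real.sqrt_eq_iff_mul_self_eq (by positivity) (by positivity)]
    have : A * s * (A * s) = A ^ 2 * s ^ 2 := by ring
    rw [this, hs2]
    field_simp
  -- Antiderivative from the half-angle substitution. It is undefined in the classical sense at
  -- `±π`, so the endpoint values are taken as limits.
  have hderiv : ∀ t ∈ Set.Ioo (-π) π, HasDerivAt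
      (fun t => 2 / (A * s) * arctan (s * tan (t / 2))) ((A + 4 * B * sin (t / 2) ^ 2)⁻¹) t := by
    intro t ht
    have hcos : 0 < cos (t / 2) :=
      cos_pos_of_mem_Ioo ⟨by linarith [ht.1], by linarith [ht.2]⟩
    have h1 : HasDerivAt (fun t : ℝ => t / 2) (1 / 2) t := (hasDerivAt_id t).div_const 2
    have h2 := ((((hasDerivAt_tan hcos.ne').comp t h1).const_mul s).arctan).const_mul (2 / (A * s))
    refine h2.congr_deriv ?_
    simp only [Function.comp, tan_eq_sin_div_cos]
    have hsin : sin (t / 2) ^ 2 = 1 - cos (t / 2) ^ 2 := by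
      rw [← sin_sq_add_cos_sq (t / 2)]; ring
    have hpos : 0 < A + 4 * B * sin (t / 2) ^ 2 := by positivity
    have hne : cos (t / 2) ^ 2 + s ^ 2 * sin (t / 2) ^ 2 ≠ 0 := by positivity
    have key : A * (cos (t / 2) ^ 2 + s ^ 2 * sin (t / 2) ^ 2) = A + 4 * B * sin (t / 2) ^ 2 := by
      rw [hs2, hsin]
      field_simp
      ring
    rw [← key]
    have e : 1 + (s * (sin (t / 2) / cos (t / 2))) ^ 2 =
        (cos (t / 2) ^ 2 + s ^ 2 * sin (t / 2) ^ 2) / cos (t / 2) ^ 2 := by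
      field_simp
    rw [e]
    field_simp
  have hhalf1 : Filter.Tendsto (fun t : ℝ => t / 2) (nhdsWithin π (Set.Iio π))
      (nhdsWithin (π / 2) (Set.Iio (π / 2))) := by
    refine tendsto_nhdsWithin_of_tendsto_nhds_of_eventually_within _ ?_ ?_
    · exact ((continuous_id.div_const 2).tendsto π).mono_left nhdsWithin_le_nhds
    · filter_upwards [self_mem_nhdsWithin] with t ht
      simp only [Set.mem_Iio] at ht ⊢
      linarith
  have hhalf2 : Filter.Tendsto (fun t : ℝ => t / 2) (nhdsWithin (-π) (Set.Ioi (-π)))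
      (nhdsWithin (-(π / 2)) (Set.Ioi (-(π / 2)))) := by
    refine tendsto_nhdsWithin_of_tendsto_nhds_of_eventually_within _ ?_ ?_
    · have := ((continuous_id.div_const (2 : ℝ)).tendsto (-π)).mono_left
        (nhdsWithin_le_nhds (s := Set.Ioi (-π)))
      simpa [neg_div] using this
    · filter_upwards [self_mem_nhdsWithin] with t ht
      simp only [Set.mem_Ioi] at ht ⊢
      linarith
  have hb := ((tendsto_arctan_atTop.mono_right nhdsWithin_le_nhds).comp
    ((Real.tendsto_tan_pi_div_two.comp hhalf1).const_mul_atTop hs0)).const_mul (2 / (A * s))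
  have ha := ((tendsto_arctan_atBot.mono_right nhdsWithin_le_nhds).comp
    ((Real.tendsto_tan_neg_pi_div_two.comp hhalf2).const_mul_atBot hs0)).const_mul (2 / (A * s))
  have hint : IntervalIntegrable (fun t => (A + 4 * B * sin (t / 2) ^ 2)⁻¹)
      MeasureTheory.volume (-π) π := by
    apply Continuous.intervalIntegrable
    refine Continuous.inv₀ (by fun_prop) fun t => ?_
    positivity
  rw [intervalIntegral.integral_eq_sub_of_hasDerivAt_of_tendsto (by linarith [pi_pos]) hderiv hint
    ha hb, hAs]
  field_simp
  ring

/-- A Carlson type bound for the `L¹` norm of an even trigonometric kernel. -/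
lemma integral_abs_cosKernel_le {N : ℕ} {c : ℕ → ℝ} {X Y β : ℝ} (hX0 : 0 < X) (hY0 : 0 < Y)
    (hβ : 0 < β) (hX : c 0 ^ 2 + 2 * ∑ k ∈ Finset.range N, c (k + 1) ^ 2 ≤ X)
    (hY : 2 * (∑ k ∈ Finset.range N, (c k - c (k + 1)) ^ 2 + c N ^ 2) ≤ Y)
    (hXY : X * Y ≤ β ^ 4) :
    ∫ t in (-π)..π, |cosKernel N c t| ≤ 2 * π * β := by
  -- These weights make each of the two quadratic terms contribute at most `πβ`, while `2√(AB) =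
  -- β/√(XY) ≥ 1/β` bounds the reciprocal term by `2πβ`.
  set A := β / (2 * X) with hA
  set B := β / (2 * Y) with hB
  have hA0 : 0 < A := by positivity
  have hB0 : 0 < B := by positivity
  have hc := continuous_cosKernel N c
  have hcont : Continuous fun t : ℝ => (A + 4 * B * sin (t / 2) ^ 2)⁻¹ := by
    refine Continuous.inv₀ (by fun_prop) fun t => ?_
    positivity
  -- `2|K| ≤ w K² + 1/w` with the weight `w = A + 4B sin²(t/2)`.
  have hpt : ∀ t : ℝ, |cosKernel N c t| ≤ 2⁻¹ * (A * cosKernel N c t ^ 2 +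
      B * (2 * sin (t / 2) * cosKernel N c t) ^ 2 + (A + 4 * B * sin (t / 2) ^ 2)⁻¹) := by
    intro t
    set w := A + 4 * B * sin (t / 2) ^ 2 with hw
    have hw0 : 0 < w := by positivity
    have e : A * cosKernel N c t ^ 2 + B * (2 * sin (t / 2) * cosKernel N c t) ^ 2 =
        w * |cosKernel N c t| ^ 2 := by
      rw [sq_abs, hw]; ring
    rw [e]
    have h1 : 0 ≤ w⁻¹ * (w * |cosKernel N c t| - 1) ^ 2 := by positivity
    have h2 : w⁻¹ * (w * |cosKernel N c t| - 1) ^ 2 =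
        w * |cosKernel N c t| ^ 2 - 2 * |cosKernel N c t| + w⁻¹ := by
      field_simp
      ring
    linarith
  have hmono := intervalIntegral.integral_mono_on (a := -π) (b := π)
    (μ := MeasureTheory.volume) (by linarith [pi_pos])
    (f := fun t => |cosKernel N c t|) (Continuous.intervalIntegrable (by fun_prop) _ _)
    (Continuous.intervalIntegrable (by fun_prop) _ _) (fun t _ => hpt t)
  refine hmono.trans ?_
  rw [intervalIntegral.integral_const_mul, intervalIntegral.integral_add
    (by apply Continuous.intervalIntegrable; fun_prop)
    (by apply Continuous.intervalIntegrable; fun_prop), intervalIntegral.integral_add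
    (by apply Continuous.intervalIntegrable; fun_prop)
    (by apply Continuous.intervalIntegrable; fun_prop), intervalIntegral.integral_const_mul,
    intervalIntegral.integral_const_mul, integral_cosKernel_sq,
    integral_two_sin_half_mul_cosKernel_sq, integral_inv_add_sin_sq hA0 hB0]
  have hAX : A * (2 * π * (c 0 ^ 2 + 2 * ∑ k ∈ Finset.range N, c (k + 1) ^ 2)) ≤ π * β := by
    calc _ ≤ A * (2 * π * X) := by gcongr
      _ = π * β := by rw [hA]; field_simp
  have hBY : B * (2 * π * (2 * (∑ k ∈ Finset.range N, (c k - c (k + 1)) ^ 2 + c N ^ 2))) ≤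
      π * β := by
    calc _ ≤ B * (2 * π * Y) := by gcongr
      _ = π * β := by rw [hB]; field_simp
  have hsq : 1 / β ≤ √(A * (A + 4 * B)) := by
    apply Real.le_sqrt_of_sq_le
    have h4 : (1 / β) ^ 2 ≤ 4 * (A * B) := by
      rw [hA, hB]
      have e : 4 * (β / (2 * X) * (β / (2 * Y))) = β ^ 2 / (X * Y) := by field_simp; ring
      rw [e, div_pow, one_pow, div_le_div_iff₀ (by positivity) (by positivity)]
      nlinarith
    nlinarith [sq_nonneg A]
  have hfin : 2 * π / √(A * (A + 4 * B)) ≤ 2 * π * β := by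
    rw [div_le_iff₀ (lt_of_lt_of_le (by positivity) hsq)]
    have : 2 * π = 2 * π * β * (1 / β) := by field_simp
    calc 2 * π = 2 * π * β * (1 / β) := this
      _ ≤ _ := by gcongr
  linarith

/-! ### Fourier multipliers on trigonometric polynomials -/

/-- The trigonometric polynomial `∑_{k ≤ d} (a_k cos kx + b_k sin kx)`. -/
def trigSum (d : ℕ) (a b : ℕ → ℝ) (x : ℝ) : ℝ :=
  ∑ k ∈ Finset.range (d + 1), (a k * cos (k * x) + b k * sin (k * x))

lemma continuous_trigSum (d : ℕ) (a b : ℕ → ℝ) : Continuous (trigSum d a b) := by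
  unfold trigSum
  fun_prop

lemma trigSum_congr {d : ℕ} {a b a' b' : ℕ → ℝ} (ha : ∀ k ≤ d, a k = a' k)
    (hb : ∀ k ≤ d, b k = b' k) (x : ℝ) : trigSum d a b x = trigSum d a' b' x := by
  refine Finset.sum_congr rfl fun k hk => ?_
  rw [ha k (by simpa [Nat.lt_succ_iff] using hk), hb k (by simpa [Nat.lt_succ_iff] using hk)]

/-- The action of the Fourier multiplier `c` on a trigonometric polynomial. -/
def trigMul (c : ℕ → ℝ) (d : ℕ) (a b : ℕ → ℝ) : ℝ → ℝ :=
  trigSum d (fun k => c k * a k) (fun k => c k * b k)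

lemma trigMul_add (c c' : ℕ → ℝ) (d : ℕ) (a b : ℕ → ℝ) (x : ℝ) :
    trigMul (fun k => c k + c' k) d a b x = trigMul c d a b x + trigMul c' d a b x := by
  simp only [trigMul, trigSum, ← Finset.sum_add_distrib]
  exact Finset.sum_congr rfl fun _ _ => by ring

lemma trigMul_sub (c c' : ℕ → ℝ) (d : ℕ) (a b : ℕ → ℝ) (x : ℝ) :
    trigMul (fun k => c k - c' k) d a b x = trigMul c d a b x - trigMul c' d a b x := by
  simp only [trigMul, trigSum, ← Finset.sum_sub_distrib]
  exact Finset.sum_congr rfl fun _ _ => by ring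

lemma trigMul_const_mul (y : ℝ) (c : ℕ → ℝ) (d : ℕ) (a b : ℕ → ℝ) (x : ℝ) :
    trigMul (fun k => y * c k) d a b x = y * trigMul c d a b x := by
  simp only [trigMul, trigSum, Finset.mul_sum]
  exact Finset.sum_congr rfl fun _ _ => by ring

lemma trigMul_one (d : ℕ) (a b : ℕ → ℝ) (x : ℝ) :
    trigMul (fun _ => 1) d a b x = trigSum d a b x := by
  simp [trigMul]

lemma trigMul_sum {ι : Type*} (s : Finset ι) (c : ι → ℕ → ℝ) (d : ℕ) (a b : ℕ → ℝ) (x : ℝ) :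
    trigMul (fun k => ∑ i ∈ s, c i k) d a b x = ∑ i ∈ s, trigMul (c i) d a b x := by
  simp only [trigMul, trigSum]
  rw [Finset.sum_comm]
  refine Finset.sum_congr rfl fun k _ => ?_
  rw [Finset.sum_add_distrib, Finset.sum_mul, Finset.sum_mul, Finset.sum_mul, Finset.sum_mul]

lemma trigMul_mul (c c' : ℕ → ℝ) (d : ℕ) (a b : ℕ → ℝ) :
    trigMul (fun k => c k * c' k) d a b =
      trigMul c d (fun k => c' k * a k) (fun k => c' k * b k) := by
  simp only [trigMul, mul_assoc]

lemma trigMul_congr {c c' : ℕ → ℝ} {d : ℕ} (h : ∀ k ≤ d, c k = c' k) (a b : ℕ → ℝ) (x : ℝ) :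
    trigMul c d a b x = trigMul c' d a b x :=
  trigSum_congr (fun k hk => by rw [h k hk]) (fun k hk => by rw [h k hk]) x

lemma trigSum_add_add_trigSum_sub (d : ℕ) (a b : ℕ → ℝ) (x s : ℝ) :
    trigSum d a b (x + s) + trigSum d a b (x - s) =
      2 * trigMul (fun k => cos (k * s)) d a b x := by
  simp only [trigMul, trigSum, ← Finset.sum_add_distrib, Finset.mul_sum]
  refine Finset.sum_congr rfl fun k _ => ?_
  rw [mul_add, mul_sub, cos_add, cos_sub, sin_add, sin_sub]
  ring

/-- A multiplier acts as convolution with its kernel. -/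
lemma integral_cosKernel_mul_trigSum {N d : ℕ} {c : ℕ → ℝ} (hc : ∀ k, k ≤ d → N < k → c k = 0)
    (a b : ℕ → ℝ) (x : ℝ) :
    ∫ t in (-π)..π, cosKernel N c t * trigSum d a b (x + t) = 2 * π * trigMul c d a b x := by
  have h : ∀ t : ℝ, cosKernel N c t * trigSum d a b (x + t) =
      ∑ k ∈ Finset.range (d + 1),
        ((a k * cos (k * x) + b k * sin (k * x)) * (cosKernel N c t * cos (k * t)) +
          (b k * cos (k * x) - a k * sin (k * x)) * (cosKernel N c t * sin (k * t))) := by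
    intro t
    rw [trigSum, Finset.mul_sum]
    refine Finset.sum_congr rfl fun k _ => ?_
    rw [mul_add (k : ℝ), cos_add, sin_add]
    ring
  have hK := continuous_cosKernel N c
  simp_rw [h]
  rw [intervalIntegral.integral_finsetSum
      (fun i _ => by apply Continuous.intervalIntegrable; fun_prop), trigMul, trigSum,
      Finset.mul_sum]
  refine Finset.sum_congr rfl fun k hk => ?_
  rw [intervalIntegral.integral_add (by apply Continuous.intervalIntegrable; fun_prop)
    (by apply Continuous.intervalIntegrable; fun_prop), intervalIntegral.integral_const_mul,
    intervalIntegral.integral_const_mul, integral_cosKernel_mul_cos, integral_cosKernel_mul_sin]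
  split_ifs with hkN
  · ring
  · rw [hc k (by simpa [Nat.lt_succ_iff] using hk) (by omega)]
    ring

/-- The multiplier is convolution with its kernel, so its norm is at most the kernel's `L¹` norm
over `2π`. Only frequencies up to `d` matter: a multiplier without finite support may be cut at any
`N ≥ d`, and `hc` is then vacuous. -/
lemma abs_trigMul_le {N d : ℕ} {c : ℕ → ℝ} {X Y β : ℝ} (hX0 : 0 < X) (hY0 : 0 < Y)
    (hβ : 0 < β) (hX : c 0 ^ 2 + 2 * ∑ k ∈ Finset.range N, c (k + 1) ^ 2 ≤ X)
    (hY : 2 * (∑ k ∈ Finset.range N, (c k - c (k + 1)) ^ 2 + c N ^ 2) ≤ Y)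
    (hXY : X * Y ≤ β ^ 4) (hc : ∀ k, k ≤ d → N < k → c k = 0) {a b : ℕ → ℝ} {M : ℝ}
    (hM : ∀ y, |trigSum d a b y| ≤ M) (x : ℝ) : |trigMul c d a b x| ≤ β * M := by
  have hL := integral_abs_cosKernel_le hX0 hY0 hβ hX hY hXY
  have hM0 : 0 ≤ M := (abs_nonneg _).trans (hM 0)
  have hK := continuous_cosKernel N c
  have hT := continuous_trigSum d a b
  have h1 : |2 * π * trigMul c d a b x| ≤ ∫ t in (-π)..π, |cosKernel N c t| * M := by
    rw [← integral_cosKernel_mul_trigSum hc]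
    refine (intervalIntegral.abs_integral_le_integral_abs (by linarith [pi_pos])).trans ?_
    refine intervalIntegral.integral_mono_on (by linarith [pi_pos])
      (Continuous.intervalIntegrable (by fun_prop) _ _)
      (Continuous.intervalIntegrable (by fun_prop) _ _) fun t _ => ?_
    rw [abs_mul]
    exact mul_le_mul_of_nonneg_left (hM _) (abs_nonneg _)
  rw [intervalIntegral.integral_mul_const, abs_mul, abs_of_pos (by positivity : 0 < 2 * π)] at h1
  have h2 : 2 * π * |trigMul c d a b x| ≤ 2 * π * (β * M) := by
    calc _ ≤ _ := h1
      _ ≤ 2 * π * β * M := by gcongr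
      _ = _ := by ring
  exact le_of_mul_le_mul_left h2 (by positivity)

lemma integral_trigSum_mul_cos (d : ℕ) (a b : ℕ → ℝ) (l : ℕ) :
    ∫ t in (-π)..π, trigSum d a b t * cos (l * t) =
      if l ≤ d then (if l = 0 then 2 * π * a 0 else π * a l) else 0 := by
  have h : ∀ t : ℝ, trigSum d a b t * cos (l * t) = ∑ k ∈ Finset.range (d + 1),
      (a k * (cos (k * t) * cos (l * t)) + b k * (cos (l * t) * sin (k * t))) := by
    intro t
    rw [trigSum, Finset.sum_mul]
    exact Finset.sum_congr rfl fun _ _ => by ring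
  simp_rw [h]
  rw [intervalIntegral.integral_finsetSum
      (fun i _ => by apply Continuous.intervalIntegrable; fun_prop)]
  have h2 : ∀ k ∈ Finset.range (d + 1), ∫ t in (-π)..π,
      (a k * (cos (k * t) * cos (l * t)) + b k * (cos (l * t) * sin (k * t))) =
      if k = l then (if l = 0 then 2 * π * a 0 else π * a l) else 0 := by
    intro k _
    rw [intervalIntegral.integral_add (by apply Continuous.intervalIntegrable; fun_prop)
      (by apply Continuous.intervalIntegrable; fun_prop), intervalIntegral.integral_const_mul,
      intervalIntegral.integral_const_mul, integral_cos_mul_cos_natCast,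
      integral_cos_mul_sin_natCast]
    split_ifs with h1 h2 h3 h4 <;> subst_vars <;> first | omega | ring
  rw [Finset.sum_congr rfl h2, Finset.sum_ite_eq']
  simp

lemma integral_trigSum_mul_sin (d : ℕ) (a b : ℕ → ℝ) (l : ℕ) :
    ∫ t in (-π)..π, trigSum d a b t * sin (l * t) =
      if l ≤ d then (if l = 0 then 0 else π * b l) else 0 := by
  have h : ∀ t : ℝ, trigSum d a b t * sin (l * t) = ∑ k ∈ Finset.range (d + 1),
      (a k * (cos (k * t) * sin (l * t)) + b k * (sin (k * t) * sin (l * t))) := by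
    intro t
    rw [trigSum, Finset.sum_mul]
    exact Finset.sum_congr rfl fun _ _ => by ring
  simp_rw [h]
  rw [intervalIntegral.integral_finsetSum
      (fun i _ => by apply Continuous.intervalIntegrable; fun_prop)]
  have h2 : ∀ k ∈ Finset.range (d + 1), ∫ t in (-π)..π,
      (a k * (cos (k * t) * sin (l * t)) + b k * (sin (k * t) * sin (l * t))) =
      if k = l then (if l = 0 then 0 else π * b l) else 0 := by
    intro k _
    rw [intervalIntegral.integral_add (by apply Continuous.intervalIntegrable; fun_prop)
      (by apply Continuous.intervalIntegrable; fun_prop), intervalIntegral.integral_const_mul,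
      intervalIntegral.integral_const_mul, integral_sin_mul_sin_natCast,
      integral_cos_mul_sin_natCast]
    split_ifs with h1 h2 h3 h4 <;> subst_vars <;> first | omega | ring
  rw [Finset.sum_congr rfl h2, Finset.sum_ite_eq']
  simp

lemma fourierSum_trigSum (i d : ℕ) (a b : ℕ → ℝ) (x : ℝ) :
    fourierSum i (trigSum d a b) x = trigMul (fun k => if k ≤ i then 1 else 0) d a b x := by
  have hc0 : cosCoeff (trigSum d a b) 0 / 2 = a 0 := by
    rw [cosCoeff, integral_trigSum_mul_cos, if_pos (Nat.zero_le _), if_pos rfl]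
    field_simp
  have hc : ∀ k ∈ Finset.Icc 1 i, cosCoeff (trigSum d a b) k * cos (k * x) +
      sinCoeff (trigSum d a b) k * sin (k * x) =
      if k ≤ d then a k * cos (k * x) + b k * sin (k * x) else 0 := by
    intro k hk
    have hk0 : k ≠ 0 := by have := (Finset.mem_Icc.1 hk).1; omega
    rw [cosCoeff, sinCoeff, integral_trigSum_mul_cos, integral_trigSum_mul_sin, if_neg hk0,
      if_neg hk0]
    split_ifs
    · field_simp
    · simp
  rw [fourierSum, hc0, Finset.sum_congr rfl hc, trigMul, trigSum, Finset.range_eq_Ico,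
    Finset.sum_eq_sum_Ico_succ_bot (Nat.succ_pos d), ← Finset.sum_filter]
  have h2 : ∀ k ∈ Finset.Ico (0 + 1) (d + 1), (if k ≤ i then (1 : ℝ) else 0) * a k * cos (k * x) +
      (if k ≤ i then (1 : ℝ) else 0) * b k * sin (k * x) =
      if k ≤ i then a k * cos (k * x) + b k * sin (k * x) else 0 := by
    intro k _
    split_ifs <;> ring
  rw [Finset.sum_congr rfl h2, ← Finset.sum_filter]
  congr 1
  · simp
  · refine Finset.sum_congr ?_ fun _ _ => rfl
    ext k
    simp only [Finset.mem_filter, Finset.mem_Icc, Finset.mem_Ico]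
    omega

/-- The multiplier of the de la Vallée Poussin sum. -/
def valleeCoeff (m n k : ℕ) : ℝ := ((n - max m k : ℕ) : ℝ) / ((n - m : ℕ) : ℝ)

lemma valleePoussin_trigSum {m n : ℕ} (hmn : m < n) (d : ℕ) (a b : ℕ → ℝ) (x : ℝ) :
    valleePoussin m n (trigSum d a b) x = trigMul (valleeCoeff m n) d a b x := by
  rw [valleePoussin]
  simp_rw [fourierSum_trigSum]
  rw [← trigMul_sum, ← trigMul_const_mul]
  refine trigMul_congr (fun k _ => ?_) a b x
  have : (Finset.Ico m n).filter (fun i => k ≤ i) = Finset.Ico (max m k) n := by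
    ext i
    simp only [Finset.mem_filter, Finset.mem_Ico]
    omega
  rw [Finset.sum_boole, this, Nat.card_Ico, valleeCoeff, Nat.cast_sub hmn.le]
  ring

/-! ### Centred differences of even order and their average over the step -/

lemma sum_range_two_mul_add_one (F : ℕ → ℝ) (p : ℕ) :
    ∑ i ∈ Finset.range (2 * p + 1), F i =
      F p + ∑ i ∈ Finset.range p, (F (p + (i + 1)) + F (p - (i + 1))) := by
  have h : 2 * p + 1 = p + (p + 1) := by ring
  rw [h, Finset.sum_range_add, Finset.sum_range_succ', Finset.sum_add_distrib]
  have h2 : ∑ i ∈ Finset.range p, F (p - (i + 1)) = ∑ i ∈ Finset.range p, F i := by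
    rw [← Finset.sum_range_reflect F p]
    exact Finset.sum_congr rfl fun i _ => by rw [Nat.sub_sub, Nat.add_comm]
  rw [h2]
  simp only [add_zero]
  ring

lemma forwardDiff_two_mul (p : ℕ) (f : ℝ → ℝ) (x t : ℝ) :
    (-1 : ℝ) ^ p * forwardDiff (2 * p) t f (x - p * t) = (2 * p).choose p * f x -
      ∑ i ∈ Finset.range p, (-1 : ℝ) ^ i * (2 * p).choose (p + (i + 1)) *
        (f (x + (i + 1 : ℕ) * t) + f (x - (i + 1 : ℕ) * t)) := by
  rw [forwardDiff, sum_range_two_mul_add_one, mul_add, Finset.mul_sum,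
    sub_eq_add_neg (_ * f x), ← Finset.sum_neg_distrib]
  have hp : (-1 : ℝ) ^ p * (-1) ^ p = 1 := by rw [← mul_pow]; simp
  congr 1
  · rw [← mul_assoc, ← mul_assoc, hp, one_mul]
    congr 2
    ring
  · refine Finset.sum_congr rfl fun i hi => ?_
    have hi' : i + 1 ≤ p := by simpa [Nat.succ_le_iff] using hi
    have hch : (2 * p).choose (p - (i + 1)) = (2 * p).choose (p + (i + 1)) :=
      Nat.choose_symm_of_eq_add (by omega)
    have hs : (-1 : ℝ) ^ p * (-1) ^ (p - (i + 1)) = -(-1) ^ i := by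
      have e : (-1 : ℝ) ^ p = (-1) ^ (p - (i + 1)) * (-1) ^ (i + 1) := by
        rw [← pow_add]; congr 1; omega
      have h1 : (-1 : ℝ) ^ (p - (i + 1)) * (-1) ^ (p - (i + 1)) = 1 := by rw [← mul_pow]; simp
      rw [e, mul_right_comm, h1, pow_succ]
      ring
    have hs' : (-1 : ℝ) ^ p * (-1) ^ (p + (i + 1)) = -(-1) ^ i := by
      rw [pow_add, ← mul_assoc, hp, pow_succ]
      ring
    rw [hch, Nat.cast_sub hi', Nat.cast_add]
    have e1 : x - p * t + (p + (i + 1 : ℕ)) * t = x + (i + 1 : ℕ) * t := by ring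
    have e2 : x - p * t + (p - (i + 1 : ℕ)) * t = x - (i + 1 : ℕ) * t := by ring
    rw [e1, e2, mul_add, ← mul_assoc, ← mul_assoc, ← mul_assoc, ← mul_assoc, hs, hs']
    ring

/-- The ratio `(2p choose p + i) / (2p choose p)`. -/
def binomRatio (p i : ℕ) : ℝ := ((2 * p).choose (p + i) : ℝ) / (2 * p).choose p

lemma centralChoose_pos (p : ℕ) : (0 : ℝ) < (2 * p).choose p := by
  exact_mod_cast Nat.choose_pos (by omega)

lemma binomRatio_nonneg (p i : ℕ) : 0 ≤ binomRatio p i := by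
  unfold binomRatio
  positivity

lemma binomRatio_le_one (p i : ℕ) : binomRatio p i ≤ 1 := by
  rw [binomRatio, div_le_one (centralChoose_pos p)]
  have := Nat.choose_le_middle (p + i) (2 * p)
  rw [Nat.mul_div_cancel_left p two_pos] at this
  exact_mod_cast this

lemma binomRatio_antitone (p : ℕ) : Antitone (binomRatio p) := by
  refine antitone_nat_of_succ_le fun i => ?_
  rw [binomRatio, binomRatio]
  refine div_le_div_of_nonneg_right ?_ (centralChoose_pos p).le
  rcases le_or_gt (2 * p) (p + i) with h | h
  · rw [Nat.choose_eq_zero_of_lt (by omega : 2 * p < p + (i + 1))]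
    simp
  · have h1 := Nat.choose_succ_right_eq (2 * p) (p + i)
    have h2 : (2 * p).choose (p + i + 1) * (p + i + 1) ≤ (2 * p).choose (p + i) * (p + i + 1) := by
      rw [h1]
      exact Nat.mul_le_mul_left _ (by omega)
    exact_mod_cast Nat.le_of_mul_le_mul_right h2 (by omega)

/-- The reason for the linear weight: averaging a cosine against it leaves a translation by `h`
divided by `(zh)²`, which is the source of the factor `(n/2k)²`. -/
lemma integral_tent_mul_cos {h z : ℝ} (hh : h ≠ 0) (hz : z ≠ 0) :
    ∫ t in (0 : ℝ)..h, 2 / h * (1 - t / h) * cos (z * t) = 2 * (1 - cos (z * h)) / (z * h) ^ 2 := by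
  have hd : ∀ t ∈ Set.uIcc 0 h, HasDerivAt
      (fun t => 2 / h * ((1 - t / h) * (sin (z * t) / z) - cos (z * t) / (h * z ^ 2)))
      (2 / h * (1 - t / h) * cos (z * t)) t := by
    intro t _
    have hl : HasDerivAt (fun t : ℝ => z * t) z t := by
      simpa using (hasDerivAt_id t).const_mul z
    have h1 : HasDerivAt (fun t : ℝ => 1 - t / h) (-(1 / h)) t := by
      simpa using ((hasDerivAt_id t).div_const h).const_sub 1
    have h2 := ((h1.mul (hl.sin.div_const z)).sub (hl.cos.div_const (h * z ^ 2))).const_mul (2 / h)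
    refine h2.congr_deriv ?_
    field_simp
    ring
  rw [intervalIntegral.integral_eq_sub_of_hasDerivAt hd
    (by apply Continuous.intervalIntegrable; fun_prop)]
  simp
  field_simp
  ring

lemma integral_tent {h : ℝ} (hh : h ≠ 0) : ∫ t in (0 : ℝ)..h, 2 / h * (1 - t / h) = 1 := by
  have hd : ∀ t ∈ Set.uIcc 0 h, HasDerivAt
      (fun t => 2 / h * (t - t ^ 2 / (2 * h))) (2 / h * (1 - t / h)) t := by
    intro t _
    have h2 := ((hasDerivAt_id t).sub (((hasDerivAt_id t).pow 2).div_const (2 * h))).const_mul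
      (2 / h)
    refine h2.congr_deriv ?_
    simp only [Nat.cast_ofNat, id, Nat.add_one_sub_one, pow_one, mul_one]
    field_simp
  rw [intervalIntegral.integral_eq_sub_of_hasDerivAt hd
    (by apply Continuous.intervalIntegrable; fun_prop)]
  field_simp
  ring

lemma integral_mul_trigMul {φ : ℝ → ℝ} (hφ : Continuous φ) {θ : ℝ → ℕ → ℝ}
    (hθ : ∀ k, Continuous fun t => θ t k) (u v : ℝ) (d : ℕ) (a b : ℕ → ℝ) (x : ℝ) :
    ∫ t in u..v, φ t * trigMul (θ t) d a b x =
      trigMul (fun k => ∫ t in u..v, φ t * θ t k) d a b x := by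
  have h : ∀ t : ℝ, φ t * trigMul (θ t) d a b x = ∑ k ∈ Finset.range (d + 1),
      (φ t * θ t k) * (a k * cos (k * x) + b k * sin (k * x)) := by
    intro t
    rw [trigMul, trigSum, Finset.mul_sum]
    exact Finset.sum_congr rfl fun _ _ => by ring
  simp_rw [h]
  rw [intervalIntegral.integral_finsetSum
      (fun i _ => by apply Continuous.intervalIntegrable; have := hθ i; fun_prop), trigMul, trigSum]
  refine Finset.sum_congr rfl fun k _ => ?_
  rw [intervalIntegral.integral_mul_const]
  ring

/-- The multiplier of the normalised centred difference of order `2p` with step `t`. -/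
def diffCoeff (p : ℕ) (t : ℝ) (k : ℕ) : ℝ :=
  1 - ∑ i ∈ Finset.range p, 2 * (-1 : ℝ) ^ i * binomRatio p (i + 1) * cos (k * ((i + 1 : ℕ) * t))

lemma trigMul_diffCoeff (p : ℕ) (t : ℝ) (d : ℕ) (a b : ℕ → ℝ) (x : ℝ) :
    trigMul (diffCoeff p t) d a b x = ((2 * p).choose p : ℝ)⁻¹ *
      ((-1 : ℝ) ^ p * forwardDiff (2 * p) t (trigSum d a b) (x - p * t)) := by
  have hne := (centralChoose_pos p).ne'
  rw [forwardDiff_two_mul]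
  unfold diffCoeff
  rw [trigMul_sub, trigMul_one, trigMul_sum, mul_sub, ← mul_assoc, inv_mul_cancel₀ hne, one_mul,
    Finset.mul_sum]
  congr 1
  refine Finset.sum_congr rfl fun i _ => ?_
  rw [trigMul_const_mul, trigSum_add_add_trigSum_sub, binomRatio]
  ring

/-- The average of `diffCoeff p t` over `0 ≤ t ≤ h` against a linearly decreasing weight. -/
def avgDiffCoeff (p : ℕ) (h : ℝ) (k : ℕ) : ℝ :=
  ∫ t in (0 : ℝ)..h, 2 / h * (1 - t / h) * diffCoeff p t k

lemma abs_trigMul_avgDiffCoeff_le (p : ℕ) {h : ℝ} (hh : 0 < h) {d : ℕ} {a b : ℕ → ℝ} {Ω : ℝ}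
    (hΩ : ∀ t ∈ Set.Ioc 0 h, ∀ y, |forwardDiff (2 * p) t (trigSum d a b) y| ≤ Ω) (x : ℝ) :
    |trigMul (avgDiffCoeff p h) d a b x| ≤ ((2 * p).choose p : ℝ)⁻¹ * Ω := by
  have hθ : ∀ k, Continuous fun t => diffCoeff p t k := by
    intro k
    unfold diffCoeff
    fun_prop
  have hcont : Continuous fun t => trigMul (diffCoeff p t) d a b x := by
    unfold trigMul trigSum
    fun_prop
  unfold avgDiffCoeff
  rw [← integral_mul_trigMul (by fun_prop) hθ]
  refine (intervalIntegral.abs_integral_le_integral_abs hh.le).trans ?_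
  calc ∫ t in (0 : ℝ)..h, |2 / h * (1 - t / h) * trigMul (diffCoeff p t) d a b x|
      ≤ ∫ t in (0 : ℝ)..h, 2 / h * (1 - t / h) * (((2 * p).choose p : ℝ)⁻¹ * Ω) := by
        refine intervalIntegral.integral_mono_on_of_le_Ioo hh.le
          (Continuous.intervalIntegrable (by fun_prop) _ _)
          (Continuous.intervalIntegrable (by fun_prop) _ _) fun t ht => ?_
        have hw : 0 ≤ 2 / h * (1 - t / h) := by
          have : t / h ≤ 1 := (div_le_one hh).2 ht.2.le
          have : 0 ≤ 1 - t / h := by linarith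
          positivity
        rw [abs_mul, abs_of_nonneg hw, trigMul_diffCoeff, abs_mul, abs_mul, abs_pow, abs_neg,
          abs_one, one_pow, one_mul, abs_of_pos (inv_pos.2 (centralChoose_pos p))]
        have := hΩ t ⟨ht.1, ht.2.le⟩ (x - p * t)
        have := inv_pos.2 (centralChoose_pos p)
        gcongr
    _ = _ := by rw [intervalIntegral.integral_mul_const, integral_tent hh.ne', one_mul]

/-- The multiplier of a combination of translations by multiples of `h`, complementary to
`avgDiffCoeff` up to the factor `(π / (h k))²`. -/
def shiftCoeff (p : ℕ) (h : ℝ) (k : ℕ) : ℝ :=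
  4 / π ^ 2 * ∑ i ∈ Finset.range p, (-1 : ℝ) ^ i * (binomRatio p (i + 1) / (i + 1 : ℕ) ^ 2) *
    (1 - cos (k * ((i + 1 : ℕ) * h)))

lemma avgDiffCoeff_eq (p : ℕ) {h : ℝ} (hh : h ≠ 0) {k : ℕ} (hk : k ≠ 0) :
    avgDiffCoeff p h k = 1 - (π / (h * k)) ^ 2 * shiftCoeff p h k := by
  have hk' : (k : ℝ) ≠ 0 := by exact_mod_cast hk
  have e : ∀ t : ℝ, 2 / h * (1 - t / h) * diffCoeff p t k = 2 / h * (1 - t / h) -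
      ∑ i ∈ Finset.range p, 2 * (-1 : ℝ) ^ i * binomRatio p (i + 1) *
        (2 / h * (1 - t / h) * cos ((k * (i + 1 : ℕ) : ℝ) * t)) := by
    intro t
    rw [diffCoeff, mul_sub, mul_one, Finset.mul_sum]
    congr 1
    refine Finset.sum_congr rfl fun i _ => ?_
    rw [← mul_assoc (k : ℝ)]
    ring
  rw [avgDiffCoeff]
  simp_rw [e]
  rw [intervalIntegral.integral_sub (by apply Continuous.intervalIntegrable; fun_prop)
    (by apply Continuous.intervalIntegrable; fun_prop), integral_tent hh,
    intervalIntegral.integral_finsetSum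
      (fun i _ => by apply Continuous.intervalIntegrable; fun_prop), shiftCoeff, ← mul_assoc,
    Finset.mul_sum]
  congr 1
  refine Finset.sum_congr rfl fun i _ => ?_
  have hi : ((i + 1 : ℕ) : ℝ) ≠ 0 := by positivity
  rw [intervalIntegral.integral_const_mul, integral_tent_mul_cos hh (mul_ne_zero hk' hi),
    ← mul_assoc (k : ℝ)]
  field_simp
  ring

/-- The two bounds feed each other in the induction: after splitting off `b 0`, the rest is minus
the alternating sum of the shifted sequence. -/
lemma alternating_sum_mem_Icc (n : ℕ) {b : ℕ → ℝ} (hb : Antitone b) (hb0 : ∀ i, 0 ≤ b i) :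
    0 ≤ ∑ i ∈ Finset.range n, (-1 : ℝ) ^ i * b i ∧
      ∑ i ∈ Finset.range n, (-1 : ℝ) ^ i * b i ≤ b 0 := by
  induction n generalizing b with
  | zero => simpa using hb0 0
  | succ n ih =>
    rw [Finset.sum_range_succ']
    have h := ih (b := fun i => b (i + 1)) (fun i j hij => hb (by omega)) fun i => hb0 _
    have e : ∑ i ∈ Finset.range n, (-1 : ℝ) ^ (i + 1) * b (i + 1) =
        -∑ i ∈ Finset.range n, (-1 : ℝ) ^ i * b (i + 1) := by
      rw [← Finset.sum_neg_distrib]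
      exact Finset.sum_congr rfl fun _ _ => by ring
    have h01 := hb (zero_le_one)
    rw [e]
    simp only [pow_zero, one_mul, zero_add] at h ⊢
    constructor <;> linarith [h.1, h.2]

/-- Only odd denominators survive; the infinite sum is `π²/4`. The constant is `2 + 2/9` from the
first two terms plus `1/4` from a telescoping majorant of the tail. -/
lemma sum_odd_inv_sq_le (j : ℕ) :
    ∑ i ∈ Finset.range (2 * (j + 2)), ((-1 : ℝ) ^ i + 1) / ((i : ℝ) + 1) ^ 2 ≤
      89 / 36 - 1 / (2 * ((j : ℝ) + 2)) := by
  induction j with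
  | zero => norm_num [Finset.sum_range_succ]
  | succ j ih =>
    have e : 2 * (j + 1 + 2) = 2 * (j + 2) + 1 + 1 := by ring
    have hpow : (-1 : ℝ) ^ (2 * (j + 2)) = 1 := by rw [pow_mul]; norm_num
    rw [e, Finset.sum_range_succ, Finset.sum_range_succ, pow_succ (-1 : ℝ) (2 * (j + 2)), hpow]
    push_cast
    have hj : (0 : ℝ) ≤ j := Nat.cast_nonneg j
    have h1 : (1 + 1 : ℝ) / (2 * ((j : ℝ) + 2) + 1) ^ 2 ≤
        1 / (2 * ((j : ℝ) + 2)) - 1 / (2 * ((j : ℝ) + 1 + 2)) := by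
      rw [div_sub_div _ _ (by positivity) (by positivity),
        div_le_div_iff₀ (by positivity) (by positivity)]
      nlinarith
    norm_num at ih h1 ⊢
    linarith

lemma sum_alternating_add_sum_le {p : ℕ} {r : ℕ → ℝ} (hr1 : ∀ i, r i ≤ 1) :
    ∑ i ∈ Finset.range p, ((-1 : ℝ) ^ i + 1) * (r i / (i + 1 : ℕ) ^ 2) ≤ 89 / 36 := by
  have hpos : ∀ i : ℕ, (0 : ℝ) ≤ (-1 : ℝ) ^ i + 1 := by
    intro i
    rcases neg_one_pow_eq_or ℝ i with h | h <;> rw [h] <;> norm_num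
  calc ∑ i ∈ Finset.range p, ((-1 : ℝ) ^ i + 1) * (r i / (i + 1 : ℕ) ^ 2)
      ≤ ∑ i ∈ Finset.range p, ((-1 : ℝ) ^ i + 1) / ((i : ℝ) + 1) ^ 2 := by
        refine Finset.sum_le_sum fun i _ => ?_
        rw [div_eq_mul_one_div ((-1 : ℝ) ^ i + 1)]
        push_cast
        have := hpos i
        have := hr1 i
        gcongr
    _ ≤ ∑ i ∈ Finset.range (2 * (p + 2)), ((-1 : ℝ) ^ i + 1) / ((i : ℝ) + 1) ^ 2 := by
        refine Finset.sum_le_sum_of_subset_of_nonneg ?_ fun i _ _ => ?_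
        · intro i
          simp only [Finset.mem_range]
          omega
        · have := hpos i
          positivity
    _ ≤ 89 / 36 - 1 / (2 * ((p : ℝ) + 2)) := sum_odd_inv_sq_le p
    _ ≤ 89 / 36 := by
        have : (0 : ℝ) ≤ 1 / (2 * ((p : ℝ) + 2)) := by positivity
        linarith

/-- The coefficient of `f(x)` is an alternating sum, kept with its sign because it is nonnegative;
the translates cost the sum of absolute values. Adding the two cancels the even denominators, which
brings the norm down to nearly `1`. -/
lemma abs_trigMul_shiftCoeff_le (p : ℕ) (h : ℝ) {d : ℕ} {a b : ℕ → ℝ} {M : ℝ}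
    (hM : ∀ y, |trigSum d a b y| ≤ M) (x : ℝ) :
    |trigMul (shiftCoeff p h) d a b x| ≤ 1.003 * M := by
  have hM0 : 0 ≤ M := (abs_nonneg _).trans (hM 0)
  set r : ℕ → ℝ := fun i => binomRatio p (i + 1) / (i + 1 : ℕ) ^ 2 with hr
  have hr0 : ∀ i, 0 ≤ r i := fun i => div_nonneg (binomRatio_nonneg _ _) (by positivity)
  have hanti : Antitone r := by
    intro i j hij
    refine div_le_div₀ (binomRatio_nonneg _ _) (binomRatio_antitone p (by omega)) (by positivity) ?_
    gcongr
  have e : trigMul (shiftCoeff p h) d a b x =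
      4 / π ^ 2 * ((∑ i ∈ Finset.range p, (-1 : ℝ) ^ i * r i) * trigSum d a b x -
        ∑ i ∈ Finset.range p, (-1 : ℝ) ^ i * r i *
          ((trigSum d a b (x + (i + 1 : ℕ) * h) + trigSum d a b (x - (i + 1 : ℕ) * h)) / 2)) := by
    unfold shiftCoeff
    rw [trigMul_const_mul, trigMul_sum, Finset.sum_mul, ← Finset.sum_sub_distrib]
    congr 1
    refine Finset.sum_congr rfl fun i _ => ?_
    rw [trigMul_const_mul, trigMul_sub, trigMul_one, trigSum_add_add_trigSum_sub]
    ring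
  have hA := (alternating_sum_mem_Icc p hanti hr0).1
  have h1 : |(∑ i ∈ Finset.range p, (-1 : ℝ) ^ i * r i) * trigSum d a b x| ≤
      (∑ i ∈ Finset.range p, (-1 : ℝ) ^ i * r i) * M := by
    rw [abs_mul, abs_of_nonneg hA]
    exact mul_le_mul_of_nonneg_left (hM x) hA
  have h2 : |∑ i ∈ Finset.range p, (-1 : ℝ) ^ i * r i *
      ((trigSum d a b (x + (i + 1 : ℕ) * h) + trigSum d a b (x - (i + 1 : ℕ) * h)) / 2)| ≤
      (∑ i ∈ Finset.range p, r i) * M := by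
    rw [Finset.sum_mul]
    refine (Finset.abs_sum_le_sum_abs _ _).trans (Finset.sum_le_sum fun i _ => ?_)
    rw [abs_mul, abs_mul, abs_pow, abs_neg, abs_one, one_pow, one_mul, abs_of_nonneg (hr0 i)]
    refine mul_le_mul_of_nonneg_left ?_ (hr0 i)
    have := abs_le.1 (hM (x + (i + 1 : ℕ) * h))
    have := abs_le.1 (hM (x - (i + 1 : ℕ) * h))
    rw [abs_le]
    constructor <;> linarith
  have h3 : (∑ i ∈ Finset.range p, (-1 : ℝ) ^ i * r i) + ∑ i ∈ Finset.range p, r i ≤ 89 / 36 := by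
    have h := sum_alternating_add_sum_le (p := p) (r := fun i => binomRatio p (i + 1))
      (fun i => binomRatio_le_one _ _)
    rw [← Finset.sum_add_distrib]
    refine le_trans (le_of_eq (Finset.sum_congr rfl fun i _ => ?_)) h
    simp only [hr]
    ring
  rw [e, abs_mul, abs_of_pos (by positivity : 0 < 4 / π ^ 2)]
  calc _ ≤ 4 / π ^ 2 * (89 / 36 * M) := by
        refine mul_le_mul_of_nonneg_left ?_ (by positivity)
        refine (abs_sub _ _).trans ((add_le_add h1 h2).trans ?_)
        rw [← add_mul]
        exact mul_le_mul_of_nonneg_right h3 hM0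
    _ = 4 / π ^ 2 * (89 / 36) * M := by ring
    _ ≤ _ := by
        refine mul_le_mul_of_nonneg_right ?_ hM0
        rw [div_mul_eq_mul_div, div_le_iff₀ (by positivity)]
        nlinarith [pi_gt_d2]

/-! ### Norms of the three multipliers in the decomposition -/

lemma valleeCoeff_of_le {m p k : ℕ} (hp : 0 < p) (hk : k ≤ m) : valleeCoeff m (m + p) k = 1 := by
  have hp' : (p : ℝ) ≠ 0 := by positivity
  rw [valleeCoeff, max_eq_left hk, Nat.add_sub_cancel_left, div_self hp']

lemma valleeCoeff_of_ge {m p k : ℕ} (hk : m + p ≤ k) : valleeCoeff m (m + p) k = 0 := by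
  rw [valleeCoeff, Nat.sub_eq_zero_of_le (hk.trans (le_max_right _ _))]
  simp

lemma valleeCoeff_add {m p i : ℕ} (hi : i ≤ p) :
    valleeCoeff m (m + p) (m + i) = ((p : ℝ) - i) / p := by
  rw [valleeCoeff, max_eq_right (Nat.le_add_right _ _), Nat.add_sub_cancel_left,
    Nat.add_sub_add_left, Nat.cast_sub hi]

lemma sum_range_sq_real (p : ℕ) :
    ∑ i ∈ Finset.range p, (i : ℝ) ^ 2 = ((p : ℝ) - 1) * p * (2 * p - 1) / 6 := by
  induction p with
  | zero => simp
  | succ p ih =>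
    rw [Finset.sum_range_succ, ih]
    push_cast
    ring

lemma abs_trigMul_valleeCoeff_le {m p d : ℕ} (hp : 0 < p) (hm : m ≤ 8 * p) {a b : ℕ → ℝ} {M : ℝ}
    (hM : ∀ y, |trigSum d a b y| ≤ M) (x : ℝ) :
    |trigMul (valleeCoeff m (m + p)) d a b x| ≤ 2.4148 * M := by
  have hp' : (1 : ℝ) ≤ p := by exact_mod_cast hp
  have hm' : (m : ℝ) ≤ 8 * p := by exact_mod_cast hm
  have hm0 : (0 : ℝ) ≤ m := Nat.cast_nonneg m
  refine abs_trigMul_le (N := m + p) (X := 2 * m + 2 * p / 3 + 1 / (3 * p)) (Y := 2 / p)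
    (by positivity) (by positivity) (by norm_num) ?_ ?_ ?_ ?_ hM x
  · have h1 : ∑ k ∈ Finset.range m, valleeCoeff m (m + p) (k + 1) ^ 2 = m := by
      rw [Finset.sum_congr rfl fun k hk => by
        rw [valleeCoeff_of_le hp (by simpa [Nat.succ_le_iff] using hk), one_pow]]
      simp
    have h2 : ∑ i ∈ Finset.range p, valleeCoeff m (m + p) (m + i + 1) ^ 2 =
        (∑ i ∈ Finset.range p, (i : ℝ) ^ 2) / p ^ 2 := by
      rw [← Finset.sum_range_reflect (fun i : ℕ => (i : ℝ) ^ 2), Finset.sum_div]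
      refine Finset.sum_congr rfl fun i hi => ?_
      have hi' : i + 1 ≤ p := by simpa [Nat.succ_le_iff] using hi
      rw [add_assoc, valleeCoeff_add hi', Nat.sub_sub, Nat.add_comm 1, Nat.cast_sub hi', div_pow]
    rw [Finset.sum_range_add, h1, h2, sum_range_sq_real, valleeCoeff_of_le hp (Nat.zero_le _)]
    apply le_of_eq
    field_simp
    ring
  · have h1 : ∑ k ∈ Finset.range m,
        (valleeCoeff m (m + p) k - valleeCoeff m (m + p) (k + 1)) ^ 2 = 0 := by
      refine Finset.sum_eq_zero fun k hk => ?_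
      have hk' : k + 1 ≤ m := by simpa [Nat.succ_le_iff] using hk
      rw [valleeCoeff_of_le hp hk', valleeCoeff_of_le hp (by omega)]
      norm_num
    have h2 : ∑ i ∈ Finset.range p,
        (valleeCoeff m (m + p) (m + i) - valleeCoeff m (m + p) (m + i + 1)) ^ 2 = 1 / p := by
      rw [Finset.sum_congr rfl fun i hi => by
        have hi' : i + 1 ≤ p := by simpa [Nat.succ_le_iff] using hi
        rw [add_assoc, valleeCoeff_add hi', valleeCoeff_add (by omega),
          show ((p : ℝ) - i) / p - (p - (i + 1 : ℕ)) / p = 1 / p by push_cast; ring]]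
      rw [Finset.sum_const, Finset.card_range, nsmul_eq_mul]
      field_simp
    rw [Finset.sum_range_add, h1, h2, valleeCoeff_of_ge le_rfl]
    apply le_of_eq
    ring
  -- With `m/p ≤ 8` and `p ≥ 1` the product is at most `32 + 4/3 + 2/3 = 34 ≤ 2.4148⁴`.
  · have e : (2 * m + 2 * p / 3 + 1 / (3 * p)) * (2 / p) =
        4 * ((m : ℝ) / p) + 4 / 3 + 2 / 3 * (1 / p) ^ 2 := by
      field_simp
      ring
    have h1 : (m : ℝ) / p ≤ 8 := by rwa [div_le_iff₀ (by positivity)]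
    have h2 : (1 / (p : ℝ)) ^ 2 ≤ 1 := by
      refine pow_le_one₀ (by positivity) ?_
      rw [div_le_one (by positivity)]
      exact hp'
    rw [e]
    norm_num1
    linarith
  · intro k _ hk
    exact valleeCoeff_of_ge hk.le

/-- With `x = 1/j` and `y = 1/(j+1)` this reads `x - y = xy`; it turns the telescoping comparisons
below into polynomial inequalities in `x ≥ y`. -/
lemma inv_sub_inv_succ {j : ℝ} (hj : 0 < j) : j⁻¹ - (j + 1)⁻¹ = j⁻¹ * (j + 1)⁻¹ := by
  field_simp
  ring

lemma sum_inv_pow_eight_le {M : ℕ} (hM : 0 < M) (L : ℕ) :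
    ∑ i ∈ Finset.range L, (((M + i + 1 : ℕ) : ℝ)⁻¹) ^ 8 ≤
      ((M : ℝ)⁻¹ ^ 7 - ((M + L : ℕ) : ℝ)⁻¹ ^ 7) / 7 := by
  induction L with
  | zero => simp
  | succ L ih =>
    rw [Finset.sum_range_succ]
    have hj : (0 : ℝ) < (M + L : ℕ) := by positivity
    have hid := inv_sub_inv_succ hj
    have hcast : ((M + (L + 1) : ℕ) : ℝ) = (M + L : ℕ) + 1 := by push_cast; ring
    have hcast' : ((M + L + 1 : ℕ) : ℝ) = (M + L : ℕ) + 1 := by push_cast; ring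
    rw [hcast, hcast']
    have hy0 : (0 : ℝ) < (((M + L : ℕ) : ℝ) + 1)⁻¹ := by positivity
    have hxy : (((M + L : ℕ) : ℝ) + 1)⁻¹ ≤ ((M + L : ℕ) : ℝ)⁻¹ := by gcongr; linarith
    set x := ((M + L : ℕ) : ℝ)⁻¹
    set y := (((M + L : ℕ) : ℝ) + 1)⁻¹
    have key : 7 * y ^ 8 ≤ x ^ 7 - y ^ 7 := by
      have e : x ^ 7 - y ^ 7 = (x - y) * (x ^ 6 + x ^ 5 * y + x ^ 4 * y ^ 2 + x ^ 3 * y ^ 3 +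
        x ^ 2 * y ^ 4 + x * y ^ 5 + y ^ 6) := by ring
      rw [e, hid]
      calc 7 * y ^ 8 = y * y * (y ^ 6 + y ^ 5 * y + y ^ 4 * y ^ 2 + y ^ 3 * y ^ 3 +
            y ^ 2 * y ^ 4 + y * y ^ 5 + y ^ 6) := by ring
        _ ≤ _ := by gcongr
    linarith

lemma sum_inv_pow_four_le {M : ℕ} (hM : 0 < M) (L : ℕ) :
    ∑ i ∈ Finset.range L, (((M + i + 1 : ℕ) : ℝ)⁻¹) ^ 4 ≤
      ((M : ℝ)⁻¹ ^ 3 - ((M + L : ℕ) : ℝ)⁻¹ ^ 3) / 3 := by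
  induction L with
  | zero => simp
  | succ L ih =>
    rw [Finset.sum_range_succ]
    have hj : (0 : ℝ) < (M + L : ℕ) := by positivity
    have hid := inv_sub_inv_succ hj
    have hcast : ((M + (L + 1) : ℕ) : ℝ) = (M + L : ℕ) + 1 := by push_cast; ring
    have hcast' : ((M + L + 1 : ℕ) : ℝ) = (M + L : ℕ) + 1 := by push_cast; ring
    rw [hcast, hcast']
    have hy0 : (0 : ℝ) < (((M + L : ℕ) : ℝ) + 1)⁻¹ := by positivity
    have hxy : (((M + L : ℕ) : ℝ) + 1)⁻¹ ≤ ((M + L : ℕ) : ℝ)⁻¹ := by gcongr; linarith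
    set x := ((M + L : ℕ) : ℝ)⁻¹
    set y := (((M + L : ℕ) : ℝ) + 1)⁻¹
    have key : 3 * y ^ 4 ≤ x ^ 3 - y ^ 3 := by
      have e : x ^ 3 - y ^ 3 = (x - y) * (x ^ 2 + x * y + y ^ 2) := by ring
      rw [e, hid]
      calc 3 * y ^ 4 = y * y * (y ^ 2 + y * y + y ^ 2) := by ring
        _ ≤ _ := by gcongr
    linarith

lemma sum_sq_diff_inv_pow_four_le {M : ℕ} (hM : 0 < M) (L : ℕ) :
    ∑ i ∈ Finset.range L, (((M + i : ℕ) : ℝ)⁻¹ ^ 4 - ((M + i + 1 : ℕ) : ℝ)⁻¹ ^ 4) ^ 2 ≤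
      2 * ((M : ℝ)⁻¹ ^ 9 - ((M + L : ℕ) : ℝ)⁻¹ ^ 9) := by
  induction L with
  | zero => simp
  | succ L ih =>
    rw [Finset.sum_range_succ]
    have hj : (0 : ℝ) < (M + L : ℕ) := by positivity
    have hid := inv_sub_inv_succ hj
    have hcast : ((M + (L + 1) : ℕ) : ℝ) = (M + L : ℕ) + 1 := by push_cast; ring
    have hcast' : ((M + L + 1 : ℕ) : ℝ) = (M + L : ℕ) + 1 := by push_cast; ring
    rw [hcast, hcast']
    have hy0 : (0 : ℝ) < (((M + L : ℕ) : ℝ) + 1)⁻¹ := by positivity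
    have hxy : (((M + L : ℕ) : ℝ) + 1)⁻¹ ≤ ((M + L : ℕ) : ℝ)⁻¹ := by gcongr; linarith
    set x := ((M + L : ℕ) : ℝ)⁻¹
    set y := (((M + L : ℕ) : ℝ) + 1)⁻¹
    have hx0 : 0 < x := hy0.trans_le hxy
    have h4 : 0 ≤ x ^ 4 - y ^ 4 := sub_nonneg.2 (pow_le_pow_left₀ hy0.le hxy 4)
    have h5 : x ^ 4 - y ^ 4 ≤ 2 * (x ^ 5 + y ^ 5) := by
      have e : x ^ 4 - y ^ 4 = (x - y) * ((x + y) * (x ^ 2 + y ^ 2)) := by ring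
      have h6 : 0 ≤ (x ^ 4 - y ^ 4) * (x - y) := mul_nonneg h4 (by linarith)
      have h7 : 0 ≤ (x ^ 2 - y ^ 2) * (x ^ 3 - y ^ 3) :=
        mul_nonneg (sub_nonneg.2 (pow_le_pow_left₀ hy0.le hxy 2))
          (sub_nonneg.2 (pow_le_pow_left₀ hy0.le hxy 3))
      rw [e, hid]
      nlinarith
    have h8 : 0 ≤ x ^ 4 * y ^ 4 * (x - y) := by
      have : 0 ≤ x - y := by linarith
      positivity
    have key : (x ^ 4 - y ^ 4) ^ 2 ≤ 2 * (x ^ 9 - y ^ 9) := by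
      calc (x ^ 4 - y ^ 4) ^ 2 = (x ^ 4 - y ^ 4) * (x ^ 4 - y ^ 4) := sq _
        _ ≤ (x ^ 4 - y ^ 4) * (2 * (x ^ 5 + y ^ 5)) := mul_le_mul_of_nonneg_left h5 h4
        _ = 2 * (x ^ 9 - y ^ 9) - 2 * (x ^ 4 * y ^ 4 * (x - y)) := by ring
        _ ≤ _ := by linarith
    linarith

lemma sum_sq_diff_inv_sq_le {M : ℕ} (hM : 0 < M) (L : ℕ) :
    ∑ i ∈ Finset.range L, (((M + i : ℕ) : ℝ)⁻¹ ^ 2 - ((M + i + 1 : ℕ) : ℝ)⁻¹ ^ 2) ^ 2 ≤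
      (M : ℝ)⁻¹ ^ 5 - ((M + L : ℕ) : ℝ)⁻¹ ^ 5 := by
  induction L with
  | zero => simp
  | succ L ih =>
    rw [Finset.sum_range_succ]
    have hj : (0 : ℝ) < (M + L : ℕ) := by positivity
    have hid := inv_sub_inv_succ hj
    have hcast : ((M + (L + 1) : ℕ) : ℝ) = (M + L : ℕ) + 1 := by push_cast; ring
    have hcast' : ((M + L + 1 : ℕ) : ℝ) = (M + L : ℕ) + 1 := by push_cast; ring
    rw [hcast, hcast']
    have hy0 : (0 : ℝ) < (((M + L : ℕ) : ℝ) + 1)⁻¹ := by positivity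
    have hxy : (((M + L : ℕ) : ℝ) + 1)⁻¹ ≤ ((M + L : ℕ) : ℝ)⁻¹ := by gcongr; linarith
    set x := ((M + L : ℕ) : ℝ)⁻¹
    set y := (((M + L : ℕ) : ℝ) + 1)⁻¹
    have hx0 : 0 < x := hy0.trans_le hxy
    have h2 : 0 ≤ x ^ 2 - y ^ 2 := sub_nonneg.2 (pow_le_pow_left₀ hy0.le hxy 2)
    have h5 : x ^ 2 - y ^ 2 ≤ x ^ 3 + y ^ 3 := by
      have e : x ^ 2 - y ^ 2 = (x - y) * (x + y) := by ring
      have h6 : 0 ≤ (x ^ 2 - y ^ 2) * (x - y) := mul_nonneg h2 (by linarith)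
      rw [e, hid]
      nlinarith
    have h8 : 0 ≤ x ^ 2 * y ^ 2 * (x - y) := by
      have : 0 ≤ x - y := by linarith
      positivity
    have key : (x ^ 2 - y ^ 2) ^ 2 ≤ x ^ 5 - y ^ 5 := by
      calc (x ^ 2 - y ^ 2) ^ 2 = (x ^ 2 - y ^ 2) * (x ^ 2 - y ^ 2) := sq _
        _ ≤ (x ^ 2 - y ^ 2) * (x ^ 3 + y ^ 3) := mul_le_mul_of_nonneg_left h5 h2
        _ = x ^ 5 - y ^ 5 - x ^ 2 * y ^ 2 * (x - y) := by ring
        _ ≤ _ := by linarith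
    linarith

/-- An extension of `(n / 2k)⁴` from `k ≥ M` to all frequencies. -/
def quarticCoeff (M n k : ℕ) : ℝ := ((n : ℝ) / 2) ^ 4 * ((max M k : ℕ) : ℝ)⁻¹ ^ 4

/-- The multiplier will act only on functions without frequencies below `M`, so its values there are
free. Extending it by a constant adds nothing to the sum of squared differences. -/
lemma abs_trigMul_quarticCoeff_le {M n d : ℕ} (hM : 0 < M) (hn : 0 < n) (h9 : 8 * n < 9 * M)
    {a b : ℕ → ℝ} {B : ℝ} (hB : ∀ y, |trigSum d a b y| ≤ B) (x : ℝ) :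
    |trigMul (quarticCoeff M n) d a b x| ≤ 0.178 * B := by
  -- The summand `d` puts the cut beyond every frequency present; `2M²` makes the jump at the cut
  -- negligible, of order `z⁹` like the other differences.
  set L := 2 * M ^ 2 + d with hL
  set s := ((n : ℝ) / 2) ^ 4 with hs
  have hs0 : 0 < s := by positivity
  set z := (M : ℝ)⁻¹ with hz
  have hM1 : (1 : ℝ) ≤ M := by exact_mod_cast hM
  have hz0 : 0 < z := by positivity
  have hz1 : z ≤ 1 := inv_le_one_of_one_le₀ hM1
  have hMz : (M : ℝ) * z = 1 := mul_inv_cancel₀ (by positivity)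
  have hle : ∀ k ≤ M, quarticCoeff M n k = s * z ^ 4 := by
    intro k hk
    rw [quarticCoeff, max_eq_left hk]
  have hge : ∀ i, quarticCoeff M n (M + i) = s * ((M + i : ℕ) : ℝ)⁻¹ ^ 4 := by
    intro i
    rw [quarticCoeff, max_eq_right (Nat.le_add_right _ _)]
  have hlast : ((M + L : ℕ) : ℝ)⁻¹ ^ 8 ≤ 1 / 64 * z ^ 9 := by
    have h1 : ((M + L : ℕ) : ℝ)⁻¹ ≤ z ^ 2 / 2 := by
      rw [hz, inv_pow, ← one_div, ← one_div, div_div]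
      refine one_div_le_one_div_of_le (by positivity) ?_
      rw [hL]
      push_cast
      have : (0 : ℝ) ≤ d := Nat.cast_nonneg d
      nlinarith
    calc ((M + L : ℕ) : ℝ)⁻¹ ^ 8 ≤ (z ^ 2 / 2) ^ 8 := by gcongr
      _ = 1 / 256 * z ^ 9 * z ^ 7 := by ring
      _ ≤ 1 / 256 * z ^ 9 * 1 := by
        gcongr
        exact pow_le_one₀ hz0.le hz1
      _ ≤ _ := by nlinarith [pow_pos hz0 9]
  refine abs_trigMul_le (N := M + L) (X := s ^ 2 * (z ^ 7 * (16 / 7 + z)))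
    (Y := s ^ 2 * (129 / 32 * z ^ 9)) (by positivity) (by positivity) (by norm_num) ?_ ?_ ?_
    (fun k hk hk' => by omega) hB x
  · have h1 : ∑ k ∈ Finset.range M, quarticCoeff M n (k + 1) ^ 2 = s ^ 2 * z ^ 7 := by
      rw [Finset.sum_congr rfl fun k hk => by
        rw [hle _ (by simpa [Nat.succ_le_iff] using hk)]]
      rw [Finset.sum_const, Finset.card_range, nsmul_eq_mul]
      calc (M : ℝ) * (s * z ^ 4) ^ 2 = s ^ 2 * z ^ 7 * (M * z) := by ring
        _ = _ := by rw [hMz, mul_one]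
    have h2 : ∑ i ∈ Finset.range L, quarticCoeff M n (M + i + 1) ^ 2 ≤ s ^ 2 * (z ^ 7 / 7) := by
      have e : ∀ i ∈ Finset.range L, quarticCoeff M n (M + i + 1) ^ 2 =
          s ^ 2 * ((M + i + 1 : ℕ) : ℝ)⁻¹ ^ 8 := by
        intro i _
        rw [add_assoc, hge]
        ring
      rw [Finset.sum_congr rfl e, ← Finset.mul_sum]
      refine mul_le_mul_of_nonneg_left ((sum_inv_pow_eight_le hM L).trans ?_) (by positivity)
      have : 0 ≤ ((M + L : ℕ) : ℝ)⁻¹ ^ 7 := by positivity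
      linarith
    rw [Finset.sum_range_add, h1, hle 0 (Nat.zero_le _)]
    calc _ ≤ (s * z ^ 4) ^ 2 + 2 * (s ^ 2 * z ^ 7 + s ^ 2 * (z ^ 7 / 7)) := by gcongr
      _ = _ := by ring
  · have h1 : ∑ k ∈ Finset.range M, (quarticCoeff M n k - quarticCoeff M n (k + 1)) ^ 2 = 0 := by
      refine Finset.sum_eq_zero fun k hk => ?_
      have hk' : k + 1 ≤ M := by simpa [Nat.succ_le_iff] using hk
      rw [hle _ hk', hle _ (by omega), sub_self, zero_pow two_ne_zero]
    have h2 : ∑ i ∈ Finset.range L,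
        (quarticCoeff M n (M + i) - quarticCoeff M n (M + i + 1)) ^ 2 ≤ s ^ 2 * (2 * z ^ 9) := by
      have e : ∀ i ∈ Finset.range L, (quarticCoeff M n (M + i) - quarticCoeff M n (M + i + 1)) ^ 2 =
          s ^ 2 * (((M + i : ℕ) : ℝ)⁻¹ ^ 4 - ((M + i + 1 : ℕ) : ℝ)⁻¹ ^ 4) ^ 2 := by
        intro i _
        rw [hge, add_assoc, hge]
        ring
      rw [Finset.sum_congr rfl e, ← Finset.mul_sum]
      refine mul_le_mul_of_nonneg_left ((sum_sq_diff_inv_pow_four_le hM L).trans ?_)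
        (by positivity)
      have : 0 ≤ ((M + L : ℕ) : ℝ)⁻¹ ^ 9 := by positivity
      linarith
    rw [Finset.sum_range_add, h1, hge]
    calc _ ≤ 2 * (0 + s ^ 2 * (2 * z ^ 9) + s ^ 2 * (1 / 64 * z ^ 9)) := by
          have e : (s * ((M + L : ℕ) : ℝ)⁻¹ ^ 4) ^ 2 = s ^ 2 * ((M + L : ℕ) : ℝ)⁻¹ ^ 8 := by ring
          rw [e]
          gcongr
      _ = _ := by ring
  · have e : s ^ 2 * (z ^ 7 * (16 / 7 + z)) * (s ^ 2 * (129 / 32 * z ^ 9)) =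
        (n / 2 * z) ^ 16 * (16 / 7 + z) * (129 / 32) := by
      rw [hs]
      ring
    rw [e]
    -- For `M ≥ 9` the ratio `n/(2M)` is near `9/16` but `z ≤ 1/9`; for `M < 9` integrality improves
    -- `8n < 9M` to `n ≤ M`, which outweighs `z ≤ 1`.
    rcases le_or_gt 9 M with h | h
    · have hz9 : z ≤ 1 / 9 := by
        rw [hz, ← one_div]
        refine one_div_le_one_div_of_le (by norm_num) (by exact_mod_cast h)
      have hlam : (n : ℝ) / 2 * z ≤ 9 / 16 := by
        have : (8 : ℝ) * n ≤ 9 * M := by exact_mod_cast h9.le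
        nlinarith
      calc ((n : ℝ) / 2 * z) ^ 16 * (16 / 7 + z) * (129 / 32)
          ≤ (9 / 16) ^ 16 * (16 / 7 + 1 / 9) * (129 / 32) := by gcongr
        _ ≤ 0.178 ^ 4 := by norm_num
    · have hnM : n ≤ M := by omega
      have hlam : (n : ℝ) / 2 * z ≤ 1 / 2 := by
        have : (n : ℝ) ≤ M := by exact_mod_cast hnM
        nlinarith
      calc ((n : ℝ) / 2 * z) ^ 16 * (16 / 7 + z) * (129 / 32)
          ≤ (1 / 2) ^ 16 * (16 / 7 + 1) * (129 / 32) := by gcongr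
        _ ≤ 0.178 ^ 4 := by norm_num

/-- The multiplier `(1 - v_k) (n / 2k)²`, where `v` is the de la Vallée Poussin multiplier. -/
def tailCoeff (m n k : ℕ) : ℝ := (1 - valleeCoeff m n k) * ((n : ℝ) / 2 * (k : ℝ)⁻¹) ^ 2

/-- Increments of `i/(m+i)²`, the shape of `tailCoeff` on the ramp `m ≤ k ≤ m + p`. For `i ≥ 1`,
with `x = 1/(m+i)` and `y = 1/(m+i+1)`, the increment lies between `-y²` and `xy`. -/
lemma abs_sub_div_sq_le (m i : ℕ) :
    |(i : ℝ) * ((m + i : ℕ) : ℝ)⁻¹ ^ 2 - ((i + 1 : ℕ) : ℝ) * ((m + i + 1 : ℕ) : ℝ)⁻¹ ^ 2| ≤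
      ((m + 1 : ℕ) : ℝ)⁻¹ ^ 2 := by
  rcases Nat.eq_zero_or_pos i with rfl | hi
  · simp
  · have hj0 : (0 : ℝ) < (m + i : ℕ) := by positivity
    have hid := inv_sub_inv_succ hj0
    have hx : ((m + i : ℕ) : ℝ)⁻¹ ≤ ((m + 1 : ℕ) : ℝ)⁻¹ := by
      gcongr
      omega
    have hix : (i : ℝ) * ((m + i : ℕ) : ℝ)⁻¹ ≤ 1 := by
      rw [← div_eq_mul_inv, div_le_one hj0]
      exact_mod_cast Nat.le_add_left i m
    have hi0 : (0 : ℝ) ≤ i := Nat.cast_nonneg i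
    have hcast : ((m + i + 1 : ℕ) : ℝ) = (m + i : ℕ) + 1 := by push_cast; ring
    have hcast' : ((i + 1 : ℕ) : ℝ) = i + 1 := by push_cast; ring
    rw [hcast, hcast']
    have hy0 : (0 : ℝ) < (((m + i : ℕ) : ℝ) + 1)⁻¹ := by positivity
    have hxy : (((m + i : ℕ) : ℝ) + 1)⁻¹ ≤ ((m + i : ℕ) : ℝ)⁻¹ := by gcongr; linarith
    set x := ((m + i : ℕ) : ℝ)⁻¹
    set y := (((m + i : ℕ) : ℝ) + 1)⁻¹
    set w := ((m + 1 : ℕ) : ℝ)⁻¹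
    have hx0 : 0 < x := hy0.trans_le hxy
    have hsq : y ^ 2 ≤ x ^ 2 := pow_le_pow_left₀ hy0.le hxy 2
    have hw : x ^ 2 ≤ w ^ 2 := pow_le_pow_left₀ hx0.le hx 2
    rw [abs_le]
    constructor
    · nlinarith
    · have e : (i : ℝ) * x ^ 2 - (i + 1) * y ^ 2 = i * x * y * (x + y) - y ^ 2 := by
        have : (i : ℝ) * x ^ 2 - i * y ^ 2 = i * (x - y) * (x + y) := by ring
        rw [hid] at this
        linarith
      have h1 : (i : ℝ) * x * y * (x + y) ≤ 1 * y * (x + y) := by gcongr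
      rw [e]
      nlinarith

lemma tailCoeff_add {m p i : ℕ} (hp : 0 < p) (hi : i ≤ p) :
    tailCoeff m (m + p) (m + i) =
      (((m + p : ℕ) : ℝ) / 2) ^ 2 / p * (i * ((m + i : ℕ) : ℝ)⁻¹ ^ 2) := by
  have hp' : (p : ℝ) ≠ 0 := by positivity
  rw [tailCoeff, valleeCoeff_add hi, mul_pow]
  field_simp
  ring

lemma tailCoeff_of_le {m p k : ℕ} (hp : 0 < p) (hk : k ≤ m) : tailCoeff m (m + p) k = 0 := by
  rw [tailCoeff, valleeCoeff_of_le hp hk, sub_self, zero_mul]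

lemma tailCoeff_of_ge {m p i : ℕ} : tailCoeff m (m + p) (m + p + i) =
    (((m + p : ℕ) : ℝ) / 2) ^ 2 * ((m + p + i : ℕ) : ℝ)⁻¹ ^ 2 := by
  rw [tailCoeff, valleeCoeff_of_ge (Nat.le_add_right _ _), sub_zero, one_mul, mul_pow]

lemma abs_trigMul_tailCoeff_le {m P d : ℕ} (h8 : m ≤ 8 * (P + 1)) (h9 : 8 * P ≤ m)
    {a b : ℕ → ℝ} {B : ℝ} (hB : ∀ y, |trigSum d a b y| ≤ B) (x : ℝ) :
    |trigMul (tailCoeff m (m + (P + 1))) d a b x| ≤ 0.64 * B := by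
  obtain ⟨p, hp⟩ : ∃ p, p = P + 1 := ⟨_, rfl⟩
  obtain ⟨n, hn⟩ : ∃ n, n = m + p := ⟨_, rfl⟩
  have hp0 : 0 < p := by omega
  have hn0 : 0 < n := by omega
  set L := 2 * n ^ 2 + d with hL
  have hp1 : (1 : ℝ) ≤ p := by exact_mod_cast hp0
  have hn1 : (1 : ℝ) ≤ n := by exact_mod_cast hn0
  have hP : 9 * (P : ℝ) ≤ n - 1 := by
    have : 9 * P + 1 ≤ n := by omega
    have : 9 * (P : ℝ) + 1 ≤ n := by exact_mod_cast this
    linarith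
  have hpn : (n : ℝ) ≤ 9 * p := by
    have : n ≤ 9 * p := by omega
    exact_mod_cast this
  set lam := (n : ℝ) / 2 * ((m + 1 : ℕ) : ℝ)⁻¹ with hlam
  have hlam0 : 0 ≤ lam := by positivity
  have hlam1 : lam ≤ 9 / 16 := by
    have h : 8 * n ≤ 9 * (m + 1) := by omega
    have h : (8 : ℝ) * n ≤ 9 * (m + 1 : ℕ) := by exact_mod_cast h
    rw [hlam, ← div_eq_mul_inv, div_le_iff₀ (by positivity)]
    linarith
  have hlam4 : lam ^ 4 ≤ 6561 / 65536 := by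
    calc lam ^ 4 ≤ (9 / 16) ^ 4 := by gcongr
      _ = _ := by norm_num
  set u := (n : ℝ)⁻¹ with hu
  have hu0 : 0 < u := by positivity
  have hu1 : u ≤ 1 := inv_le_one_of_one_le₀ hn1
  have hnu : (n : ℝ) * u = 1 := mul_inv_cancel₀ (by positivity)
  have hlow : ∀ k ≤ m, tailCoeff m n k = 0 := fun k hk => by
    rw [hn]; exact tailCoeff_of_le hp0 hk
  have hmid : ∀ i ≤ p, tailCoeff m n (m + i) =
      ((n : ℝ) / 2) ^ 2 / p * (i * ((m + i : ℕ) : ℝ)⁻¹ ^ 2) := fun i hi => by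
    rw [hn]; exact tailCoeff_add hp0 hi
  have hhigh : ∀ i, tailCoeff m n (n + i) = ((n : ℝ) / 2) ^ 2 * ((n + i : ℕ) : ℝ)⁻¹ ^ 2 :=
    fun i => by rw [hn]; exact tailCoeff_of_ge
  have hlast : ((n + L : ℕ) : ℝ)⁻¹ ^ 4 ≤ 1 / 16 * u ^ 5 := by
    have h1 : ((n + L : ℕ) : ℝ)⁻¹ ≤ u ^ 2 / 2 := by
      rw [hu, inv_pow, ← one_div, ← one_div, div_div]
      refine one_div_le_one_div_of_le (by positivity) ?_
      rw [hL]
      push_cast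
      have : (0 : ℝ) ≤ d := Nat.cast_nonneg d
      nlinarith
    calc ((n + L : ℕ) : ℝ)⁻¹ ^ 4 ≤ (u ^ 2 / 2) ^ 4 := by gcongr
      _ = 1 / 16 * u ^ 5 * u ^ 3 := by ring
      _ ≤ 1 / 16 * u ^ 5 * 1 := by
        gcongr
        exact pow_le_one₀ hu0.le hu1
      _ = _ := by ring
  rw [← hp, ← hn]
  refine abs_trigMul_le (N := n + L) (X := 2 * (P * lam ^ 4 + (1 / 16 + n / 48)))
    (Y := 2 * (lam ^ 4 / p + 17 / 256 * u)) (by positivity) (by positivity) (by norm_num) ?_ ?_ ?_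
    (fun k hk hk' => by omega) hB x
  · have hN : n + L = m + (P + (1 + L)) := by omega
    have h1 : ∑ k ∈ Finset.range m, tailCoeff m n (k + 1) ^ 2 = 0 := by
      refine Finset.sum_eq_zero fun k hk => ?_
      rw [hlow _ (by simpa [Nat.succ_le_iff] using hk), zero_pow two_ne_zero]
    have h2 : ∑ i ∈ Finset.range P, tailCoeff m n (m + i + 1) ^ 2 ≤ P * lam ^ 4 := by
      have hterm : ∀ i ∈ Finset.range P, tailCoeff m n (m + i + 1) ^ 2 ≤ lam ^ 4 := by
        intro i hi
        have hi' : i < P := Finset.mem_range.1 hi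
        have h0 : (0 : ℝ) ≤ ((i + 1 : ℕ) : ℝ) / p := by positivity
        have h1 : ((i + 1 : ℕ) : ℝ) / p ≤ 1 := by
          rw [div_le_one (by positivity)]
          exact_mod_cast (by omega : i + 1 ≤ p)
        have h2 : ((m + (i + 1) : ℕ) : ℝ)⁻¹ ≤ ((m + 1 : ℕ) : ℝ)⁻¹ := by
          gcongr
          omega
        have e : tailCoeff m n (m + (i + 1)) =
            ((i + 1 : ℕ) : ℝ) / p * ((n : ℝ) / 2 * ((m + (i + 1) : ℕ) : ℝ)⁻¹) ^ 2 := by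
          rw [hmid _ (by omega)]
          ring
        rw [add_assoc, e]
        calc _ ≤ (1 * ((n : ℝ) / 2 * ((m + 1 : ℕ) : ℝ)⁻¹) ^ 2) ^ 2 := by gcongr
          _ = lam ^ 4 := by rw [hlam]; ring
      calc _ ≤ ∑ i ∈ Finset.range P, lam ^ 4 := Finset.sum_le_sum hterm
        _ = _ := by rw [Finset.sum_const, Finset.card_range, nsmul_eq_mul]
    have h3 : ∑ i ∈ Finset.range (1 + L), tailCoeff m n (m + (P + i) + 1) ^ 2 ≤
        1 / 16 + n / 48 := by
      have e : ∀ i ∈ Finset.range (1 + L), tailCoeff m n (m + (P + i) + 1) ^ 2 =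
          ((n : ℝ) / 2) ^ 4 * ((n + i : ℕ) : ℝ)⁻¹ ^ 4 := by
        intro i _
        rw [show m + (P + i) + 1 = n + i by omega, hhigh]
        ring
      rw [Finset.sum_congr rfl e, ← Finset.mul_sum, Nat.add_comm 1, Finset.sum_range_succ']
      have h4 := sum_inv_pow_four_le hn0 L
      have h5 : (0 : ℝ) ≤ ((n + L : ℕ) : ℝ)⁻¹ ^ 3 := by positivity
      calc _ ≤ ((n : ℝ) / 2) ^ 4 * (u ^ 3 / 3 + u ^ 4) := by
            refine mul_le_mul_of_nonneg_left (add_le_add ?_ (by simp [hu])) (by positivity)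
            refine h4.trans ?_
            rw [← hu]
            linarith
        _ = (n * u) ^ 3 * n / 48 + (n * u) ^ 4 / 16 := by ring
        _ = _ := by rw [hnu]; ring
    rw [hN, Finset.sum_range_add, Finset.sum_range_add, h1, hlow 0 (Nat.zero_le _)]
    linarith
  · have h1 : ∑ k ∈ Finset.range m, (tailCoeff m n k - tailCoeff m n (k + 1)) ^ 2 = 0 := by
      refine Finset.sum_eq_zero fun k hk => ?_
      have hk' : k + 1 ≤ m := by simpa [Nat.succ_le_iff] using hk
      rw [hlow _ hk', hlow _ (by omega), sub_self, zero_pow two_ne_zero]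
    have h2 : ∑ i ∈ Finset.range p, (tailCoeff m n (m + i) - tailCoeff m n (m + i + 1)) ^ 2 ≤
        lam ^ 4 / p := by
      have hterm : ∀ i ∈ Finset.range p,
          (tailCoeff m n (m + i) - tailCoeff m n (m + i + 1)) ^ 2 ≤ lam ^ 4 / p ^ 2 := by
        intro i hi
        have hi' : i < p := Finset.mem_range.1 hi
        have h0 := sq_le_sq' (abs_le.1 (abs_sub_div_sq_le m i)).1
          (abs_le.1 (abs_sub_div_sq_le m i)).2
        rw [add_assoc, hmid _ hi'.le, hmid _ (by omega), ← mul_sub, mul_pow]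
        calc _ ≤ (((n : ℝ) / 2) ^ 2 / p) ^ 2 * (((m + 1 : ℕ) : ℝ)⁻¹ ^ 2) ^ 2 :=
              mul_le_mul_of_nonneg_left h0 (by positivity)
          _ = _ := by rw [hlam]; ring
      calc _ ≤ ∑ i ∈ Finset.range p, lam ^ 4 / (p : ℝ) ^ 2 := Finset.sum_le_sum hterm
        _ = _ := by
          rw [Finset.sum_const, Finset.card_range, nsmul_eq_mul]
          field_simp
    have h3 : ∑ i ∈ Finset.range L, (tailCoeff m n (n + i) - tailCoeff m n (n + i + 1)) ^ 2 ≤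
        ((n : ℝ) / 2) ^ 4 * u ^ 5 := by
      have e : ∀ i ∈ Finset.range L, (tailCoeff m n (n + i) - tailCoeff m n (n + i + 1)) ^ 2 =
          ((n : ℝ) / 2) ^ 4 *
            (((n + i : ℕ) : ℝ)⁻¹ ^ 2 - ((n + i + 1 : ℕ) : ℝ)⁻¹ ^ 2) ^ 2 := by
        intro i _
        rw [hhigh, add_assoc, hhigh]
        ring
      rw [Finset.sum_congr rfl e, ← Finset.mul_sum]
      refine mul_le_mul_of_nonneg_left ((sum_sq_diff_inv_sq_le hn0 L).trans ?_) (by positivity)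
      have : 0 ≤ ((n + L : ℕ) : ℝ)⁻¹ ^ 5 := by positivity
      rw [← hu]
      linarith
    have h4 : tailCoeff m n (n + L) ^ 2 ≤ ((n : ℝ) / 2) ^ 4 * (1 / 16 * u ^ 5) := by
      have e : (((n : ℝ) / 2) ^ 2 * ((n + L : ℕ) : ℝ)⁻¹ ^ 2) ^ 2 =
          ((n : ℝ) / 2) ^ 4 * ((n + L : ℕ) : ℝ)⁻¹ ^ 4 := by ring
      rw [hhigh, e]
      gcongr
    have h5 : ((n : ℝ) / 2) ^ 4 * u ^ 5 = u / 16 := by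
      calc _ = (n * u) ^ 4 * u / 16 := by ring
        _ = _ := by rw [hnu]; ring
    have hsplit : ∑ k ∈ Finset.range n, (tailCoeff m n k - tailCoeff m n (k + 1)) ^ 2 =
        ∑ k ∈ Finset.range m, (tailCoeff m n k - tailCoeff m n (k + 1)) ^ 2 +
        ∑ i ∈ Finset.range p, (tailCoeff m n (m + i) - tailCoeff m n (m + i + 1)) ^ 2 := by
      rw [← Finset.sum_range_add (fun k => (tailCoeff m n k - tailCoeff m n (k + 1)) ^ 2), ← hn]
    rw [Finset.sum_range_add, hsplit, h1]
    linarith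
  · have hX : 2 * (P * lam ^ 4 + (1 / 16 + n / 48)) ≤
        2 * (6561 / 65536 / 9 + 1 / 48) * n + 2 * (1 / 16 - 6561 / 65536 / 9) := by
      have : (P : ℝ) * lam ^ 4 ≤ ((n - 1) / 9) * (6561 / 65536) := by
        gcongr
        · linarith
      linarith
    have hX0 : 0 ≤ 2 * (P * lam ^ 4 + (1 / 16 + (n : ℝ) / 48)) := by positivity
    -- For small `n` the bound `p ≥ 1` is used, for larger `n` the bound `p ≥ n/9`.
    rcases le_or_gt n 9 with h | h
    · have hn9 : (n : ℝ) ≤ 9 := by exact_mod_cast h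
      have hY : 2 * (lam ^ 4 / p + 17 / 256 * u) ≤ 2 * (6561 / 65536) + 17 / 128 * u := by
        have : lam ^ 4 / p ≤ 6561 / 65536 / 1 := by gcongr
        linarith
      calc _ ≤ (2 * (6561 / 65536 / 9 + 1 / 48) * n + 2 * (1 / 16 - 6561 / 65536 / 9)) *
            (2 * (6561 / 65536) + 17 / 128 * u) :=
            mul_le_mul hX hY (by positivity) (hX0.trans hX)
        _ = 2 * (6561 / 65536 / 9 + 1 / 48) * (2 * (6561 / 65536)) * n +
            2 * (6561 / 65536 / 9 + 1 / 48) * (17 / 128) * (n * u) +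
            2 * (1 / 16 - 6561 / 65536 / 9) * (2 * (6561 / 65536)) +
            2 * (1 / 16 - 6561 / 65536 / 9) * (17 / 128) * u := by ring
        _ ≤ 0.64 ^ 4 := by
          rw [hnu]
          norm_num1
          linarith
    · have hn9 : (10 : ℝ) ≤ n := by exact_mod_cast h
      have hu9 : u ≤ 1 / 10 := by
        rw [hu, ← one_div]
        exact one_div_le_one_div_of_le (by norm_num) hn9
      have hY : 2 * (lam ^ 4 / p + 17 / 256 * u) ≤ (18 * (6561 / 65536) + 17 / 128) * u := by
        have h1 : lam ^ 4 / p ≤ 6561 / 65536 / (n / 9) := by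
          gcongr
          linarith
        have h2 : 6561 / 65536 / ((n : ℝ) / 9) = 9 * (6561 / 65536) * u := by
          rw [hu]
          field_simp
        linarith
      calc _ ≤ (2 * (6561 / 65536 / 9 + 1 / 48) * n + 2 * (1 / 16 - 6561 / 65536 / 9)) *
            ((18 * (6561 / 65536) + 17 / 128) * u) :=
            mul_le_mul hX hY (by positivity) (hX0.trans hX)
        _ = 2 * (6561 / 65536 / 9 + 1 / 48) * (18 * (6561 / 65536) + 17 / 128) * (n * u) +
            2 * (1 / 16 - 6561 / 65536 / 9) * (18 * (6561 / 65536) + 17 / 128) * u := by ring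
        _ ≤ 0.64 ^ 4 := by
          rw [hnu]
          norm_num1
          linarith

/-! ### The decomposition of `1 - v` and the estimate for polynomials -/

lemma bddAbove_range_abs_trigSum (d : ℕ) (a b : ℕ → ℝ) :
    BddAbove (Set.range fun x => |trigSum d a b x|) := by
  refine ⟨∑ k ∈ Finset.range (d + 1), (|a k| + |b k|), ?_⟩
  rintro _ ⟨x, rfl⟩
  refine (Finset.abs_sum_le_sum_abs _ _).trans (Finset.sum_le_sum fun k _ => ?_)
  refine (abs_add_le _ _).trans (add_le_add ?_ ?_)
  · rw [abs_mul]
    exact mul_le_of_le_one_right (abs_nonneg _) (abs_cos_le_one _)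
  · rw [abs_mul]
    exact mul_le_of_le_one_right (abs_nonneg _) (abs_sin_le_one _)

/-- For `k > m`, substitute `1 = w + qD` into `1 - v`, and once more into the resulting `(1 - v) q
D`. For `k ≤ m` both sides vanish, whatever value `quarticCoeff` has there. -/
lemma one_sub_valleeCoeff_eq (κ : ℕ) {m p : ℕ} (hp : 0 < p) (k : ℕ) :
    1 - valleeCoeff m (m + p) k =
      avgDiffCoeff κ (2 * π / (m + p : ℕ)) k -
        valleeCoeff m (m + p) k * avgDiffCoeff κ (2 * π / (m + p : ℕ)) k +
        tailCoeff m (m + p) k * (shiftCoeff κ (2 * π / (m + p : ℕ)) k *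
          avgDiffCoeff κ (2 * π / (m + p : ℕ)) k) +
        quarticCoeff (m + 1) (m + p) k * (shiftCoeff κ (2 * π / (m + p : ℕ)) k *
          (shiftCoeff κ (2 * π / (m + p : ℕ)) k * (1 - valleeCoeff m (m + p) k))) := by
  rcases le_or_gt k m with hk | hk
  · rw [tailCoeff_of_le hp hk, valleeCoeff_of_le hp hk]
    ring
  · have hn : ((m + p : ℕ) : ℝ) ≠ 0 := by positivity
    have hk0 : (k : ℝ) ≠ 0 := by
      have : k ≠ 0 := by omega
      exact_mod_cast this
    have hh : 2 * π / ((m + p : ℕ) : ℝ) ≠ 0 := by positivity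
    have e : π / (2 * π / ((m + p : ℕ) : ℝ) * k) = ((m + p : ℕ) : ℝ) / 2 * (k : ℝ)⁻¹ := by
      have := pi_pos.ne'
      field_simp
    rw [avgDiffCoeff_eq κ hh (by omega), e, tailCoeff, quarticCoeff, max_eq_right (by omega)]
    ring

lemma abs_sub_valleePoussin_trigSum_le (κ : ℕ) {m P d : ℕ} (h8 : m ≤ 8 * (P + 1))
    (h9 : 8 * P ≤ m) {a b : ℕ → ℝ} {Ω : ℝ}
    (hΩ : ∀ t ∈ Set.Ioc 0 (2 * π / (m + (P + 1) : ℕ)), ∀ y,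
      |forwardDiff (2 * κ) t (trigSum d a b) y| ≤ Ω) (x : ℝ) :
    |trigSum d a b x - valleePoussin m (m + (P + 1)) (trigSum d a b) x| ≤
      5 * (((2 * κ).choose κ : ℝ)⁻¹ * Ω) := by
  have hp : 0 < P + 1 := P.succ_pos
  set n := m + (P + 1) with hn
  set h := 2 * π / (n : ℝ) with hh
  have hh0 : 0 < h := by
    have : (0 : ℝ) < n := by positivity
    positivity
  set T := ((2 * κ).choose κ : ℝ)⁻¹ * Ω with hT
  set v := valleeCoeff m n with hv
  set w := avgDiffCoeff κ h with hw
  set D := shiftCoeff κ h with hD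
  have hW : ∀ y, |trigMul w d a b y| ≤ T := abs_trigMul_avgDiffCoeff_le κ hh0 hΩ
  have hVW : ∀ y, |trigMul (fun k => v k * w k) d a b y| ≤ 2.4148 * T := by
    intro y
    rw [trigMul_mul]
    exact abs_trigMul_valleeCoeff_le hp h8 hW y
  have hDW : ∀ y, |trigMul (fun k => D k * w k) d a b y| ≤ 1.003 * T := by
    intro y
    rw [trigMul_mul]
    exact abs_trigMul_shiftCoeff_le κ h hW y
  have hQ : ∀ y, |trigMul (fun k => tailCoeff m n k * (D k * w k)) d a b y| ≤
      0.64 * (1.003 * T) := by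
    intro y
    rw [trigMul_mul]
    exact abs_trigMul_tailCoeff_le h8 h9 hDW y
  -- The norm to be estimated; its finiteness is what allows the last term to be absorbed.
  set G := ⨆ y, |trigMul (fun k => 1 - v k) d a b y| with hG
  have hgG : ∀ y, |trigMul (fun k => 1 - v k) d a b y| ≤ G :=
    fun y => le_ciSup (f := fun y => |trigMul (fun k => 1 - v k) d a b y|)
      (bddAbove_range_abs_trigSum _ _ _) y
  have hDg : ∀ y, |trigMul (fun k => D k * (1 - v k)) d a b y| ≤ 1.003 * G := by
    intro y
    rw [trigMul_mul]
    exact abs_trigMul_shiftCoeff_le κ h hgG y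
  have hDDg : ∀ y, |trigMul (fun k => D k * (D k * (1 - v k))) d a b y| ≤
      1.003 * (1.003 * G) := by
    intro y
    rw [trigMul_mul]
    exact abs_trigMul_shiftCoeff_le κ h hDg y
  have hE : ∀ y, |trigMul (fun k => quarticCoeff (m + 1) n k * (D k * (D k * (1 - v k)))) d a b y| ≤
      0.178 * (1.003 * (1.003 * G)) := by
    intro y
    rw [trigMul_mul]
    exact abs_trigMul_quarticCoeff_le m.succ_pos (by omega) (by omega) hDDg y
  have hdecomp : ∀ y, |trigMul (fun k => 1 - v k) d a b y| ≤
      T + 2.4148 * T + 0.64 * (1.003 * T) + 0.178 * (1.003 * (1.003 * G)) := by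
    intro y
    rw [trigMul_congr (fun k _ => one_sub_valleeCoeff_eq κ hp k), trigMul_add, trigMul_add,
      trigMul_sub]
    have h1 := abs_le.1 (hW y)
    have h2 := abs_le.1 (hVW y)
    have h3 := abs_le.1 (hQ y)
    have h4 := abs_le.1 (hE y)
    rw [abs_le]
    constructor <;> linarith
  have hGle : G ≤ T + 2.4148 * T + 0.64 * (1.003 * T) + 0.178 * (1.003 * (1.003 * G)) :=
    ciSup_le hdecomp
  have hT0 : 0 ≤ T := (abs_nonneg _).trans (hW 0)
  rw [valleePoussin_trigSum (by omega), ← trigMul_one d a b x, ← trigMul_sub]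
  refine (hgG x).trans ?_
  -- `(1 + 2.4148 + 0.64 · 1.003) / (1 - 0.178 · 1.003²) < 4.95`.
  norm_num1 at hGle
  linarith

/-! ### Passage from polynomials to continuous functions -/

lemma forwardDiff_succ (r : ℕ) (h : ℝ) (f : ℝ → ℝ) (x : ℝ) :
    forwardDiff (r + 1) h f x = forwardDiff r h f x - forwardDiff r h f (x + h) := by
  simp only [forwardDiff]
  rw [Finset.sum_range_succ' _ (r + 1)]
  have h1 : ∀ i ∈ Finset.range (r + 1),
      (-1 : ℝ) ^ (i + 1) * ((r + 1).choose (i + 1) : ℝ) * f (x + (i + 1 : ℕ) * h) =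
      (-1 : ℝ) ^ (i + 1) * (r.choose (i + 1) : ℝ) * f (x + (i + 1 : ℕ) * h) -
        (-1 : ℝ) ^ i * (r.choose i : ℝ) * f (x + h + i * h) := by
    intro i _
    have e : x + h + i * h = x + (i + 1 : ℕ) * h := by push_cast; ring
    rw [e, Nat.choose_succ_succ]
    push_cast
    ring
  rw [Finset.sum_congr rfl h1, Finset.sum_sub_distrib, Finset.sum_range_succ, Nat.choose_succ_self,
    Finset.sum_range_succ' (fun i => (-1 : ℝ) ^ i * (r.choose i : ℝ) * f (x + i * h)) r]
  simp
  ring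

lemma abs_forwardDiff_le (r : ℕ) (h : ℝ) {f : ℝ → ℝ} {M : ℝ} (hM : ∀ y, |f y| ≤ M) (x : ℝ) :
    |forwardDiff r h f x| ≤ 2 ^ r * M := by
  induction r generalizing x with
  | zero => simpa [forwardDiff] using hM x
  | succ r ih =>
    rw [forwardDiff_succ]
    have h1 := abs_le.1 (ih x)
    have h2 := abs_le.1 (ih (x + h))
    rw [abs_le, pow_succ]
    constructor <;> linarith

lemma forwardDiff_sub (r : ℕ) (h : ℝ) (f g : ℝ → ℝ) (x : ℝ) :
    forwardDiff r h (fun y => f y - g y) x = forwardDiff r h f x - forwardDiff r h g x := by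
  simp only [forwardDiff, ← Finset.sum_sub_distrib]
  exact Finset.sum_congr rfl fun _ _ => by ring

lemma cosCoeff_sub {f g : ℝ → ℝ} (hf : Continuous f) (hg : Continuous g) (k : ℕ) :
    cosCoeff (fun y => f y - g y) k = cosCoeff f k - cosCoeff g k := by
  simp only [cosCoeff, sub_mul]
  rw [intervalIntegral.integral_sub (by apply Continuous.intervalIntegrable; fun_prop)
    (by apply Continuous.intervalIntegrable; fun_prop), mul_sub]

lemma sinCoeff_sub {f g : ℝ → ℝ} (hf : Continuous f) (hg : Continuous g) (k : ℕ) :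
    sinCoeff (fun y => f y - g y) k = sinCoeff f k - sinCoeff g k := by
  simp only [sinCoeff, sub_mul]
  rw [intervalIntegral.integral_sub (by apply Continuous.intervalIntegrable; fun_prop)
    (by apply Continuous.intervalIntegrable; fun_prop), mul_sub]

lemma valleePoussin_sub (m n : ℕ) {f g : ℝ → ℝ} (hf : Continuous f) (hg : Continuous g) (x : ℝ) :
    valleePoussin m n (fun y => f y - g y) x = valleePoussin m n f x - valleePoussin m n g x := by
  simp only [valleePoussin, fourierSum, cosCoeff_sub hf hg, sinCoeff_sub hf hg, ← mul_sub,
    ← Finset.sum_sub_distrib]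
  congr 1
  refine Finset.sum_congr rfl fun i _ => ?_
  rw [sub_div, add_sub_add_comm, ← Finset.sum_sub_distrib]
  congr 1
  exact Finset.sum_congr rfl fun _ _ => by ring

lemma abs_one_div_pi_mul_integral_le {g : ℝ → ℝ} {M : ℝ} (hM : ∀ y, |g y| ≤ M) :
    |1 / π * ∫ t in (-π)..π, g t| ≤ 2 * M := by
  have h := intervalIntegral.norm_integral_le_of_norm_le_const (a := -π) (b := π) (C := M)
    (f := g) (fun t _ => hM t)
  rw [sub_neg_eq_add, abs_of_pos (by positivity), Real.norm_eq_abs] at h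
  rw [abs_mul, abs_of_pos (by positivity)]
  calc 1 / π * |∫ t in (-π)..π, g t| ≤ 1 / π * (M * (π + π)) := by gcongr
    _ = 2 * M := by field_simp; ring

lemma abs_cosCoeff_le {f : ℝ → ℝ} {M : ℝ} (hM : ∀ y, |f y| ≤ M) (k : ℕ) :
    |cosCoeff f k| ≤ 2 * M := by
  refine abs_one_div_pi_mul_integral_le fun y => ?_
  rw [abs_mul]
  exact (mul_le_of_le_one_right (abs_nonneg _) (abs_cos_le_one _)).trans (hM y)

lemma abs_sinCoeff_le {f : ℝ → ℝ} {M : ℝ} (hM : ∀ y, |f y| ≤ M) (k : ℕ) :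
    |sinCoeff f k| ≤ 2 * M := by
  refine abs_one_div_pi_mul_integral_le fun y => ?_
  rw [abs_mul]
  exact (mul_le_of_le_one_right (abs_nonneg _) (abs_sin_le_one _)).trans (hM y)

/-- A crude bound suffices: `C` only multiplies an error that tends to `0` in the density argument.
-/
lemma exists_abs_valleePoussin_le (m n : ℕ) : ∃ C : ℝ, 0 ≤ C ∧ ∀ (f : ℝ → ℝ) (M : ℝ),
    (∀ y, |f y| ≤ M) → ∀ x, |valleePoussin m n f x| ≤ C * M := by
  refine ⟨|1 / ((n : ℝ) - m)| * ∑ i ∈ Finset.Ico m n, (1 + ∑ _k ∈ Finset.Icc 1 i, (4 : ℝ)),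
    by positivity, fun f M hM x => ?_⟩
  rw [valleePoussin, abs_mul, mul_assoc, Finset.sum_mul]
  refine mul_le_mul_of_nonneg_left ?_ (abs_nonneg _)
  refine (Finset.abs_sum_le_sum_abs _ _).trans (Finset.sum_le_sum fun i _ => ?_)
  rw [fourierSum, add_mul, Finset.sum_mul]
  refine (abs_add_le _ _).trans (add_le_add ?_ ?_)
  · rw [abs_div, abs_two]
    linarith [abs_cosCoeff_le hM 0]
  · refine (Finset.abs_sum_le_sum_abs _ _).trans (Finset.sum_le_sum fun k _ => ?_)
    refine (abs_add_le _ _).trans ?_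
    have h1 : |cosCoeff f k * cos (k * x)| ≤ 2 * M := by
      rw [abs_mul]
      exact (mul_le_of_le_one_right (abs_nonneg _) (abs_cos_le_one _)).trans (abs_cosCoeff_le hM k)
    have h2 : |sinCoeff f k * sin (k * x)| ≤ 2 * M := by
      rw [abs_mul]
      exact (mul_le_of_le_one_right (abs_nonneg _) (abs_sin_le_one _)).trans (abs_sinCoeff_le hM k)
    linarith

lemma exists_eq_trigSum {d : ℕ} {τ : ℝ → ℝ} (hτ : τ ∈ trigPoly d) : ∃ a b, τ = trigSum d a b := by
  obtain ⟨a, b, h⟩ := hτ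
  exact ⟨a, b, funext h⟩

/-- The space of trigonometric polynomials of degree at most `d`. -/
def trigPolySubmodule (d : ℕ) : Submodule ℝ (ℝ → ℝ) where
  carrier := trigPoly d
  zero_mem' := ⟨0, 0, fun x => by simp⟩
  add_mem' := by
    rintro f g ⟨a, b, hf⟩ ⟨a', b', hg⟩
    refine ⟨a + a', b + b', fun x => ?_⟩
    rw [Pi.add_apply, hf, hg, ← Finset.sum_add_distrib]
    refine Finset.sum_congr rfl fun k _ => ?_
    simp only [Pi.add_apply]
    ring
  smul_mem' := by
    rintro c f ⟨a, b, hf⟩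
    refine ⟨c • a, c • b, fun x => ?_⟩
    rw [Pi.smul_apply, hf, smul_eq_mul, Finset.mul_sum]
    refine Finset.sum_congr rfl fun k _ => ?_
    simp only [Pi.smul_apply, smul_eq_mul]
    ring

lemma cos_mem_trigPoly {d k : ℕ} (hk : k ≤ d) :
    (fun x => cos (k * x)) ∈ trigPolySubmodule d := by
  refine ⟨fun j => if j = k then 1 else 0, 0, fun x => ?_⟩
  simp [hk]

lemma sin_mem_trigPoly {d k : ℕ} (hk : k ≤ d) :
    (fun x => sin (k * x)) ∈ trigPolySubmodule d := by
  refine ⟨0, fun j => if j = k then 1 else 0, fun x => ?_⟩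
  simp [hk]

lemma trigPolySubmodule_mono : Monotone trigPolySubmodule := by
  intro d e hde τ hτ
  obtain ⟨a, b, rfl⟩ := exists_eq_trigSum hτ
  have h : trigSum d a b = ∑ k ∈ Finset.range (d + 1),
      (a k • (fun x => cos (k * x)) + b k • (fun x => sin (k * x))) := by
    ext x
    simp [trigSum]
  rw [h]
  refine Submodule.sum_mem _ fun k hk => ?_
  have hk' : k ≤ e := by
    have := Finset.mem_range.1 hk
    omega
  exact Submodule.add_mem _ (Submodule.smul_mem _ _ (cos_mem_trigPoly hk'))
    (Submodule.smul_mem _ _ (sin_mem_trigPoly hk'))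

lemma fourierSum_mem_trigPoly {i d : ℕ} (hi : i ≤ d) (f : ℝ → ℝ) :
    fourierSum i f ∈ trigPolySubmodule d := by
  have h : fourierSum i f = (cosCoeff f 0 / 2) • (fun x => cos ((0 : ℕ) * x)) +
      ∑ k ∈ Finset.Icc 1 i, (cosCoeff f k • (fun x => cos (k * x)) +
        sinCoeff f k • (fun x => sin (k * x))) := by
    ext x
    simp [fourierSum]
  rw [h]
  refine Submodule.add_mem _ (Submodule.smul_mem _ _ (cos_mem_trigPoly (Nat.zero_le _)))
    (Submodule.sum_mem _ fun k hk => ?_)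
  have hk' : k ≤ d := (Finset.mem_Icc.1 hk).2.trans hi
  exact Submodule.add_mem _ (Submodule.smul_mem _ _ (cos_mem_trigPoly hk'))
    (Submodule.smul_mem _ _ (sin_mem_trigPoly hk'))

lemma valleePoussin_mem_trigPoly (m n : ℕ) (f : ℝ → ℝ) :
    valleePoussin m n f ∈ trigPoly (n - 1) := by
  have h : valleePoussin m n f =
      (1 / ((n : ℝ) - (m : ℝ))) • ∑ i ∈ Finset.Ico m n, fourierSum i f := by
    ext x
    simp [valleePoussin]
  rw [h]
  refine Submodule.smul_mem (trigPolySubmodule (n - 1)) _ (Submodule.sum_mem _ fun i hi => ?_)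
  refine fourierSum_mem_trigPoly ?_ f
  have := (Finset.mem_Ico.1 hi).2
  omega

lemma re_mul_fourier_mem_trigPoly (z : ℂ) (k : ℤ) :
    (fun x : ℝ => (z * fourier k (x : AddCircle (2 * π))).re) ∈ trigPoly k.natAbs := by
  have h : ∀ x : ℝ, (z * fourier k (x : AddCircle (2 * π))).re =
      z.re * cos (k * x) - z.im * sin (k * x) := by
    intro x
    have e : 2 * (π : ℂ) * Complex.I * k * x / ((2 * π : ℝ) : ℂ) =
        ((k * x : ℝ) : ℂ) * Complex.I := by
      have : (π : ℂ) ≠ 0 := by exact_mod_cast pi_pos.ne'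
      push_cast
      field_simp
    rw [fourier_coe_apply, e, Complex.mul_re, Complex.exp_ofReal_mul_I_re,
      Complex.exp_ofReal_mul_I_im]
  simp_rw [h]
  rcases Int.natAbs_eq k with hk | hk
  · have e : (fun x : ℝ => z.re * cos (k * x) - z.im * sin (k * x)) =
        z.re • (fun x => cos (k.natAbs * x)) + (-z.im) • (fun x => sin (k.natAbs * x)) := by
      ext x
      nth_rewrite 1 2 [hk]
      simp
      ring
    rw [e]
    exact Submodule.add_mem _ (Submodule.smul_mem _ _ (cos_mem_trigPoly le_rfl))
      (Submodule.smul_mem _ _ (sin_mem_trigPoly le_rfl))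
  · have e : (fun x : ℝ => z.re * cos (k * x) - z.im * sin (k * x)) =
        z.re • (fun x => cos (k.natAbs * x)) + z.im • (fun x => sin (k.natAbs * x)) := by
      ext x
      nth_rewrite 1 2 [hk]
      simp
    rw [e]
    exact Submodule.add_mem _ (Submodule.smul_mem _ _ (cos_mem_trigPoly le_rfl))
      (Submodule.smul_mem _ _ (sin_mem_trigPoly le_rfl))

/-- Real parts do not commute with complex scalars; the free factor `z` lets the induction absorb
them. -/
lemma re_mul_mem_trigPoly_of_mem_span {g : C(AddCircle (2 * π), ℂ)}
    (hg : g ∈ Submodule.span ℂ (Set.range (@fourier (2 * π)))) (z : ℂ) :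
    ∃ d, (fun x : ℝ => (z * g (x : AddCircle (2 * π))).re) ∈ trigPolySubmodule d := by
  induction hg using Submodule.span_induction generalizing z with
  | mem g hg =>
    obtain ⟨k, rfl⟩ := hg
    exact ⟨_, re_mul_fourier_mem_trigPoly z k⟩
  | zero =>
    refine ⟨0, ?_⟩
    convert Submodule.zero_mem (trigPolySubmodule 0) using 1
    ext x
    simp
  | add f g _ _ hf hg =>
    obtain ⟨d, hd⟩ := hf z
    obtain ⟨e, he⟩ := hg z
    refine ⟨max d e, ?_⟩
    convert Submodule.add_mem _ (trigPolySubmodule_mono (le_max_left d e) hd)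
      (trigPolySubmodule_mono (le_max_right d e) he) using 1
    ext x
    simp [mul_add]
  | smul c g _ hg =>
    obtain ⟨d, hd⟩ := hg (z * c)
    refine ⟨d, ?_⟩
    convert hd using 1
    ext x
    simp [mul_assoc]

/-- Weierstrass' theorem for periodic functions. -/
lemma exists_trigSum_near {f : ℝ → ℝ} (hf : f ∈ periodicC) {ε : ℝ} (hε : 0 < ε) :
    ∃ d a b, ∀ x, |f x - trigSum d a b x| ≤ ε := by
  have : Fact (0 < 2 * π) := ⟨by positivity⟩
  obtain ⟨hfc, hfp⟩ := hf
  have hcont : Continuous (hfp.lift : AddCircle (2 * π) → ℝ) := continuous_coinduced_dom.mpr hfc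
  set F : C(AddCircle (2 * π), ℂ) :=
    ⟨fun x => ((hfp.lift x : ℝ) : ℂ), Complex.continuous_ofReal.comp hcont⟩ with hF
  have hmem : F ∈ (Submodule.span ℂ (Set.range (@fourier (2 * π)))).topologicalClosure := by
    rw [span_fourier_closure_eq_top]
    trivial
  obtain ⟨g, hg, hdist⟩ := Metric.mem_closure_iff.1 hmem ε hε
  obtain ⟨d, hd⟩ := re_mul_mem_trigPoly_of_mem_span hg 1
  obtain ⟨a, b, hab⟩ := exists_eq_trigSum hd
  refine ⟨d, a, b, fun x => ?_⟩
  rw [← hab]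
  have h1 : f x - (1 * g (x : AddCircle (2 * π))).re = (F x - g x).re := by
    rw [one_mul, Complex.sub_re]
    rfl
  have h2 := ContinuousMap.dist_apply_le_dist (f := F) (g := g) (x : AddCircle (2 * π))
  rw [h1]
  rw [Complex.dist_eq] at h2
  exact (Complex.abs_re_le_norm _).trans (h2.trans hdist.le)

lemma abs_sub_valleePoussin_le_of_even (κ : ℕ) {m P : ℕ} (h8 : m ≤ 8 * (P + 1))
    (h9 : 8 * P ≤ m) {f : ℝ → ℝ} (hf : f ∈ periodicC) {Ω : ℝ}
    (hΩ : ∀ t ∈ Set.Ioc 0 (2 * π / (m + (P + 1) : ℕ)), ∀ y,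
      |forwardDiff (2 * κ) t f y| ≤ Ω) (x : ℝ) :
    |f x - valleePoussin m (m + (P + 1)) f x| ≤ 5 * (((2 * κ).choose κ : ℝ)⁻¹ * Ω) := by
  obtain ⟨C, hC0, hC⟩ := exists_abs_valleePoussin_le m (m + (P + 1))
  set γ := ((2 * κ).choose κ : ℝ)⁻¹ with hγ
  have hγ0 : 0 < γ := inv_pos.2 (centralChoose_pos κ)
  -- Total cost of replacing `f` by a polynomial at distance `ε`: in `f` itself, in its differences,
  -- and in its de la Vallée Poussin sum.
  set A := 1 + 5 * (γ * 2 ^ (2 * κ)) + C with hA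
  have hA0 : 0 < A := by positivity
  refine le_of_forall_pos_le_add fun η hη => ?_
  obtain ⟨d, a, b, hab⟩ := exists_trigSum_near hf (div_pos hη hA0)
  set ε := η / A with hε
  have hT := continuous_trigSum d a b
  have h1 := abs_sub_valleePoussin_trigSum_le κ h8 h9 (a := a) (b := b) (d := d)
    (Ω := Ω + 2 ^ (2 * κ) * ε) (fun t ht y => by
      have h2 := abs_forwardDiff_le (2 * κ) t hab y
      rw [forwardDiff_sub] at h2
      have h3 := abs_le.1 h2
      have h4 := abs_le.1 (hΩ t ht y)
      rw [abs_le]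
      constructor <;> linarith) x
  have h2 := hC _ ε hab x
  rw [valleePoussin_sub _ _ hf.1 hT] at h2
  have h3 := abs_le.1 (hab x)
  have h4 := abs_le.1 h1
  have h5 := abs_le.1 h2
  have h6 : η = ε + 5 * (γ * (2 ^ (2 * κ) * ε)) + C * ε := by
    have : η = A * ε := by rw [hε]; field_simp
    rw [this, hA]
    ring
  rw [abs_le]
  constructor <;> linarith

/-! ### All orders, and the upper bounds (a) and (b) -/

lemma gammaStar_even (κ : ℕ) : gammaStar (2 * κ) = ((2 * κ).choose κ : ℝ)⁻¹ := by
  rw [gammaStar, Nat.mul_div_cancel_left κ two_pos, one_div]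

lemma gammaStar_odd (κ : ℕ) :
    gammaStar (2 * κ + 1) = 2 * ((2 * (κ + 1)).choose (κ + 1) : ℝ)⁻¹ := by
  have h : (2 * κ + 1) / 2 = κ := by omega
  have h2 : (2 * (κ + 1)).choose (κ + 1) = 2 * (2 * κ + 1).choose κ := by
    rw [show 2 * (κ + 1) = (2 * κ + 1) + 1 by ring, Nat.choose_succ_succ, Nat.choose_symm_half]
    ring
  have h3 : (0 : ℝ) < (2 * κ + 1).choose κ := by exact_mod_cast Nat.choose_pos (by omega)
  rw [gammaStar, h, h2]
  push_cast
  field_simp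

lemma gammaStar_pos (r : ℕ) : 0 < gammaStar r := by
  have : (0 : ℝ) < r.choose (r / 2) := by exact_mod_cast Nat.choose_pos (Nat.div_le_self _ _)
  rw [gammaStar]
  positivity

lemma abs_sub_valleePoussin_le (r : ℕ) {m P : ℕ} (h8 : m ≤ 8 * (P + 1))
    (h9 : 8 * P ≤ m) {f : ℝ → ℝ} (hf : f ∈ periodicC) {Ω : ℝ}
    (hΩ : ∀ t ∈ Set.Ioc 0 (2 * π / (m + (P + 1) : ℕ)), ∀ y, |forwardDiff r t f y| ≤ Ω) (x : ℝ) :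
    |f x - valleePoussin m (m + (P + 1)) f x| ≤ 5 * gammaStar r * Ω := by
  rcases Nat.even_or_odd' r with ⟨κ, rfl | rfl⟩
  · rw [gammaStar_even, mul_assoc]
    exact abs_sub_valleePoussin_le_of_even κ h8 h9 hf hΩ x
  · rw [gammaStar_odd]
    refine (abs_sub_valleePoussin_le_of_even (κ + 1) h8 h9 hf (Ω := 2 * Ω)
      (fun t ht y => ?_) x).trans (le_of_eq (by ring))
    rw [show 2 * (κ + 1) = (2 * κ + 1) + 1 by ring, forwardDiff_succ]
    have h1 := abs_le.1 (hΩ t ht y)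
    have h2 := abs_le.1 (hΩ t ht (y + t))
    rw [abs_le]
    constructor <;> linarith

lemma supNorm_le_ofReal {g : ℝ → ℝ} {c : ℝ} (h : ∀ x, |g x| ≤ c) :
    supNorm g ≤ ENNReal.ofReal c := by
  refine iSup_le fun x => ?_
  rw [Real.enorm_eq_ofReal_abs]
  exact ENNReal.ofReal_le_ofReal (h x)

lemma abs_le_toReal_supNorm {g : ℝ → ℝ} (h : supNorm g ≠ ∞) (x : ℝ) :
    |g x| ≤ (supNorm g).toReal := by
  rw [← ENNReal.ofReal_le_iff_le_toReal h, ← Real.enorm_eq_ofReal_abs]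
  exact le_iSup (fun x => ‖g x‖ₑ) x

lemma supNorm_sub_valleePoussin_le (r : ℕ) {m P : ℕ} (h8 : m ≤ 8 * (P + 1))
    (h9 : 8 * P ≤ m) {f : ℝ → ℝ} (hf : f ∈ periodicC) :
    supNorm (fun x => f x - valleePoussin m (m + (P + 1)) f x) ≤
      ENNReal.ofReal (5 * gammaStar r) * modulus r f (2 * π / (m + (P + 1) : ℕ)) := by
  have hγ := gammaStar_pos r
  set ω := modulus r f (2 * π / (m + (P + 1) : ℕ)) with hω
  by_cases htop : ω = ∞
  · rw [htop, ENNReal.mul_top (by simpa using hγ)]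
    exact le_top
  · rw [← ENNReal.ofReal_toReal htop, ← ENNReal.ofReal_mul (by positivity)]
    refine supNorm_le_ofReal (abs_sub_valleePoussin_le r h8 h9 hf fun t ht y => ?_)
    have h1 : supNorm (forwardDiff r t f) ≤ ω :=
      le_iSup₂ (f := fun h (_ : h ∈ Set.Ioc 0 (2 * π / ((m + (P + 1) : ℕ) : ℝ))) =>
        supNorm (forwardDiff r h f)) t ht
    exact (abs_le_toReal_supNorm (ne_top_of_le_ne_top htop h1) y).trans
      (ENNReal.toReal_mono htop h1)

/-- With `p = P + 1 = n - m`, the floor is used only through `m ≤ 8p` (norm of `v`) and `8(p - 1) ≤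
m` (smallness of the high-frequency multipliers). -/
lemma floor_eight_ninths {n : ℕ} (hn : 1 ≤ n) :
    ∃ P, n = ⌊(8 / 9 : ℝ) * n⌋₊ + (P + 1) ∧ ⌊(8 / 9 : ℝ) * n⌋₊ ≤ 8 * (P + 1) ∧
      8 * P ≤ ⌊(8 / 9 : ℝ) * n⌋₊ := by
  set m := ⌊(8 / 9 : ℝ) * n⌋₊ with hm
  have h1 : (m : ℝ) ≤ 8 / 9 * n := Nat.floor_le (by positivity)
  have h2 : (8 / 9 : ℝ) * n < m + 1 := Nat.lt_floor_add_one _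
  have h1' : 9 * m ≤ 8 * n := by
    have : (9 : ℝ) * m ≤ 8 * n := by linarith
    exact_mod_cast this
  have h2' : 8 * n < 9 * (m + 1) := by
    have : (8 : ℝ) * n < 9 * (m + 1) := by linarith
    exact_mod_cast this
  exact ⟨n - m - 1, by omega, by omega, by omega⟩

lemma valleePoussin_bound (r : ℕ) {n : ℕ} (hn : 1 ≤ n) {f : ℝ → ℝ} (hf : f ∈ periodicC) :
    supNorm (fun x => f x - valleePoussin ⌊(8 / 9 : ℝ) * n⌋₊ n f x) ≤
      ENNReal.ofReal (5 * gammaStar r) * modulus r f (2 * π / n) := by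
  obtain ⟨P, h1, h2, h3⟩ := floor_eight_ninths hn
  have h := supNorm_sub_valleePoussin_le r h2 h3 hf
  rwa [← h1] at h

lemma stechkinConst_le (r : ℕ) {n : ℕ} (hn : 1 ≤ n) :
    stechkinConst n r (2 * π / n) ≤ ENNReal.ofReal (5 * gammaStar r) := by
  refine iSup₂_le fun f hf => ENNReal.div_le_of_le_mul ?_
  exact (iInf₂_le _ (valleePoussin_mem_trigPoly _ n f)).trans (valleePoussin_bound r hn hf)

/-! ### The lower bound (c) -/

/-- A smooth odd approximation, as `l → ∞`, of the square wave `sign (sin x)`. -/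
def smoothSquareWave (l x : ℝ) : ℝ := arctan (l * sin x) / arctan l

/-- The derivative of `smoothSquareWave l`. -/
def smoothSquareWaveDeriv (l x : ℝ) : ℝ := l * cos x / (1 + (l * sin x) ^ 2) / arctan l

lemma hasDerivAt_smoothSquareWave (l x : ℝ) :
    HasDerivAt (smoothSquareWave l) (smoothSquareWaveDeriv l x) x := by
  refine ((((hasDerivAt_sin x).const_mul l).arctan).div_const (arctan l)).congr_deriv ?_
  rw [smoothSquareWaveDeriv]
  ring

lemma continuous_smoothSquareWave (l : ℝ) : Continuous (smoothSquareWave l) :=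
  continuous_iff_continuousAt.2 fun x => (hasDerivAt_smoothSquareWave l x).continuousAt

lemma continuous_smoothSquareWaveDeriv (l : ℝ) : Continuous (smoothSquareWaveDeriv l) := by
  unfold smoothSquareWaveDeriv
  refine (Continuous.div (by fun_prop) (by fun_prop) fun x => ?_).div_const _
  positivity

lemma smoothSquareWave_mem_periodicC (l : ℝ) : smoothSquareWave l ∈ periodicC :=
  ⟨continuous_smoothSquareWave l, fun x => by simp [smoothSquareWave]⟩

lemma smoothSquareWave_neg (l x : ℝ) : smoothSquareWave l (-x) = -smoothSquareWave l x := by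
  simp [smoothSquareWave, arctan_neg, neg_div]

lemma arctan_pos_of_pos {l : ℝ} (hl : 0 < l) : 0 < arctan l := by
  rw [← arctan_zero]
  exact arctan_strictMono hl

lemma abs_smoothSquareWave_le_one {l : ℝ} (hl : 0 < l) (x : ℝ) : |smoothSquareWave l x| ≤ 1 := by
  have h0 := arctan_pos_of_pos hl
  rw [smoothSquareWave, abs_div, abs_of_pos h0, div_le_one h0, abs_le, ← arctan_neg]
  constructor <;> refine arctan_strictMono.monotone ?_
  · nlinarith [neg_one_le_sin x]
  · nlinarith [sin_le_one x]

/-- The absolute derivative is `π`-periodic, and on `[-π/2, π/2]` the function increases from `-1`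
to `1`. -/
lemma integral_abs_smoothSquareWaveDeriv {l : ℝ} (hl : 0 < l) (x : ℝ) :
    ∫ t in x..(x + π), |smoothSquareWaveDeriv l t| = 2 := by
  have h0 := arctan_pos_of_pos hl
  have hper : Function.Periodic (fun t => |smoothSquareWaveDeriv l t|) π := by
    intro t
    simp only [smoothSquareWaveDeriv, cos_add_pi, sin_add_pi, mul_neg, neg_div, abs_neg, neg_sq]
  rw [hper.intervalIntegral_add_eq x (-(π / 2)), show -(π / 2) + π = π / 2 by ring]
  have h1 : ∫ t in (-(π / 2))..(π / 2), |smoothSquareWaveDeriv l t| =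
      ∫ t in (-(π / 2))..(π / 2), smoothSquareWaveDeriv l t := by
    refine intervalIntegral.integral_congr fun t ht => ?_
    rw [Set.uIcc_of_le (by linarith [pi_pos])] at ht
    have hc := cos_nonneg_of_mem_Icc ht
    simp only [smoothSquareWaveDeriv]
    rw [abs_of_nonneg (by positivity)]
  rw [h1, intervalIntegral.integral_eq_sub_of_hasDerivAt
    (fun t _ => hasDerivAt_smoothSquareWave l t)
    ((continuous_smoothSquareWaveDeriv l).intervalIntegrable _ _), smoothSquareWave_neg]
  have h2 : smoothSquareWave l (π / 2) = 1 := by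
    rw [smoothSquareWave, sin_pi_div_two, mul_one, div_self h0.ne']
  rw [h2]
  norm_num

/-- The difference of order `s + 1` is a difference of order `s` of first increments. These are
taken on adjacent intervals of total length `(s+1)h ≤ π`, so the largest binomial coefficient times
the variation `2` bounds it. -/
lemma abs_forwardDiff_smoothSquareWave_le {l : ℝ} (hl : 0 < l) (s : ℕ) {h : ℝ} (h0 : 0 < h)
    (hle : h ≤ π / (s + 1 : ℕ)) (x : ℝ) :
    |forwardDiff (s + 1) h (smoothSquareWave l) x| ≤ 2 * s.choose (s / 2) := by
  set f := smoothSquareWave l with hf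
  set g := smoothSquareWaveDeriv l with hg
  have hgc : Continuous fun t => |g t| := (continuous_smoothSquareWaveDeriv l).abs
  set u : ℕ → ℝ := fun i => x + i * h with hu
  have hu1 : ∀ i, u i ≤ u (i + 1) := by
    intro i
    simp only [hu]
    push_cast
    linarith
  have e : forwardDiff (s + 1) h f x =
      ∑ i ∈ Finset.range (s + 1), (-1 : ℝ) ^ i * (s.choose i : ℝ) * (f (u i) - f (u (i + 1))) := by
    rw [forwardDiff_succ, forwardDiff, forwardDiff, ← Finset.sum_sub_distrib]
    refine Finset.sum_congr rfl fun i _ => ?_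
    have : x + h + i * h = u (i + 1) := by simp only [hu]; push_cast; ring
    rw [this, mul_sub]
  have hterm : ∀ i, |f (u i) - f (u (i + 1))| ≤ ∫ t in (u i)..(u (i + 1)), |g t| := by
    intro i
    rw [abs_sub_comm, ← intervalIntegral.integral_eq_sub_of_hasDerivAt
      (fun t _ => hasDerivAt_smoothSquareWave l t)
      ((continuous_smoothSquareWaveDeriv l).intervalIntegrable _ _)]
    exact intervalIntegral.abs_integral_le_integral_abs (hu1 i)
  have hend : u (s + 1) ≤ x + π := by
    have : ((s + 1 : ℕ) : ℝ) * h ≤ π := by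
      rw [le_div_iff₀ (by positivity)] at hle
      linarith
    simp only [hu]
    linarith
  rw [e]
  calc _ ≤ ∑ i ∈ Finset.range (s + 1), (s.choose (s / 2) : ℝ) * ∫ t in (u i)..(u (i + 1)), |g t| := by
        refine (Finset.abs_sum_le_sum_abs _ _).trans (Finset.sum_le_sum fun i _ => ?_)
        rw [abs_mul, abs_mul, abs_pow, abs_neg, abs_one, one_pow, one_mul, Nat.abs_cast]
        refine mul_le_mul ?_ (hterm i) (abs_nonneg _) (Nat.cast_nonneg _)
        exact_mod_cast Nat.choose_le_middle i s
    _ = s.choose (s / 2) * ∫ t in (u 0)..(u (s + 1)), |g t| := by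
        rw [← Finset.mul_sum, intervalIntegral.sum_integral_adjacent_intervals
          fun i _ => hgc.intervalIntegrable _ _]
    _ ≤ s.choose (s / 2) * ∫ t in x..(x + π), |g t| := by
        refine mul_le_mul_of_nonneg_left ?_ (Nat.cast_nonneg _)
        have hu0 : u 0 = x := by simp [hu]
        rw [hu0]
        refine intervalIntegral.integral_mono_interval le_rfl ?_ hend
          (Filter.Eventually.of_forall fun t => abs_nonneg _) (hgc.intervalIntegrable _ _)
        simp only [hu]
        have : 0 ≤ ((s + 1 : ℕ) : ℝ) * h := by positivity
        linarith
    _ = _ := by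
        rw [hg, integral_abs_smoothSquareWaveDeriv hl]
        ring

lemma modulus_smoothSquareWave_le {l : ℝ} (hl : 0 < l) (s : ℕ) {δ : ℝ}
    (hδ : δ ≤ π / (s + 1 : ℕ)) :
    modulus (s + 1) (smoothSquareWave l) δ ≤ ENNReal.ofReal (2 * s.choose (s / 2)) :=
  iSup₂_le fun _ hh => supNorm_le_ofReal
    (abs_forwardDiff_smoothSquareWave_le hl s hh.1 (hh.2.trans hδ))

/-- A crude substitute for Bernstein's inequality: only sines survive, with coefficients at most
`2M`. -/
lemma abs_trigSum_sub_trigSum_neg_le {d : ℕ} {a b : ℕ → ℝ} {M : ℝ}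
    (hM : ∀ y, |trigSum d a b y| ≤ M) {x : ℝ} (hx : 0 ≤ x) :
    |trigSum d a b x - trigSum d a b (-x)| ≤ 4 * M * (d + 1) ^ 2 * x := by
  have hM0 : 0 ≤ M := (abs_nonneg _).trans (hM 0)
  have e : trigSum d a b x - trigSum d a b (-x) =
      ∑ k ∈ Finset.range (d + 1), 2 * (b k * sin (k * x)) := by
    rw [trigSum, trigSum, ← Finset.sum_sub_distrib]
    refine Finset.sum_congr rfl fun k _ => ?_
    rw [mul_neg, cos_neg, sin_neg]
    ring
  rw [e]
  calc _ ≤ ∑ k ∈ Finset.range (d + 1), 4 * M * (d + 1) * x := by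
        refine (Finset.abs_sum_le_sum_abs _ _).trans (Finset.sum_le_sum fun k hk => ?_)
        have hkd : k ≤ d := by
          have := Finset.mem_range.1 hk
          omega
        rcases Nat.eq_zero_or_pos k with rfl | hk0
        · simp
          positivity
        · have hb : |b k| ≤ 2 * M := by
            have h := abs_sinCoeff_le hM k
            rw [sinCoeff, integral_trigSum_mul_sin, if_pos hkd, if_neg hk0.ne'] at h
            have : 1 / π * (π * b k) = b k := by field_simp
            rwa [this] at h
          have hs : |sin (k * x)| ≤ (d + 1) * x := by
            have h1 : |sin (k * x)| ≤ |(k : ℝ) * x| := abs_sin_le_abs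
            rw [abs_of_nonneg (by positivity : (0 : ℝ) ≤ k * x)] at h1
            have h2 : (k : ℝ) ≤ d + 1 := by exact_mod_cast hkd.trans (Nat.le_succ d)
            exact h1.trans (mul_le_mul_of_nonneg_right h2 hx)
          rw [abs_mul, abs_mul, abs_two]
          calc 2 * (|b k| * |sin (k * x)|) ≤ 2 * (2 * M * ((d + 1) * x)) := by gcongr
            _ = _ := by ring
    _ = _ := by
        rw [Finset.sum_const, Finset.card_range, nsmul_eq_mul]
        push_cast
        ring

lemma exists_smoothSquareWave_gt {x : ℝ} (hx : 0 < sin x) {y : ℝ} (hy : y < 1) :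
    ∃ l, 0 < l ∧ y < smoothSquareWave l x := by
  have h1 : Filter.Tendsto (fun l => arctan (l * sin x)) Filter.atTop (nhds (π / 2)) :=
    (tendsto_arctan_atTop.mono_right nhdsWithin_le_nhds).comp
      (Filter.tendsto_id.atTop_mul_const hx)
  have h2 : Filter.Tendsto (fun l => arctan l) Filter.atTop (nhds (π / 2)) :=
    tendsto_arctan_atTop.mono_right nhdsWithin_le_nhds
  have h3 : Filter.Tendsto (fun l => smoothSquareWave l x) Filter.atTop (nhds 1) := by
    have := h1.div h2 (by positivity)
    rwa [div_self (by positivity)] at this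
  exact ((Filter.eventually_gt_atTop 0).and (h3.eventually (lt_mem_nhds hy))).exists

lemma exists_bestApprox_smoothSquareWave_ge (d : ℕ) {ε : ℝ} (hε : 0 < ε) (hε1 : ε < 1) :
    ∃ l, 0 < l ∧ ENNReal.ofReal (1 - ε) ≤ bestApprox d (smoothSquareWave l) := by
  -- Chosen so that a polynomial bounded by `2` changes by at most `ε` from `-x` to `x`, while the
  -- wave changes by more than `2 - ε`. One of the two errors is then at least `1 - ε`.
  set x := ε / (8 * ((d : ℝ) + 1) ^ 2) with hx
  have hx0 : 0 < x := by positivity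
  have hx1 : x < 1 := by
    rw [hx, div_lt_one (by positivity)]
    have : (0 : ℝ) ≤ d := Nat.cast_nonneg d
    nlinarith
  have hxd : 4 * ((d : ℝ) + 1) ^ 2 * x = ε / 2 := by
    rw [hx]
    field_simp
    norm_num
  obtain ⟨l, hl, hlx⟩ := exists_smoothSquareWave_gt
    (sin_pos_of_pos_of_lt_pi hx0 (by linarith [pi_gt_three])) (by linarith : 1 - ε / 2 < 1)
  refine ⟨l, hl, le_iInf₂ fun τ hτ => ?_⟩
  obtain ⟨a, b, rfl⟩ := exists_eq_trigSum hτ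
  set S := supNorm (fun y => smoothSquareWave l y - trigSum d a b y) with hS
  -- An error at most `1` forces the polynomial to be bounded by `2`; a larger error needs no
  -- argument.
  rcases le_or_gt S 1 with h | h
  · have htop : S ≠ ∞ := ne_top_of_le_ne_top ENNReal.one_ne_top h
    have hS1 : S.toReal ≤ 1 := by
      have := ENNReal.toReal_mono ENNReal.one_ne_top h
      simpa using this
    have hd := abs_le_toReal_supNorm htop
    have hτ2 : ∀ y, |trigSum d a b y| ≤ 2 := by
      intro y
      have h1 := abs_le.1 (hd y)
      have h2 := abs_le.1 (abs_smoothSquareWave_le_one hl y)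
      rw [abs_le]
      constructor <;> linarith
    rw [ENNReal.ofReal_le_iff_le_toReal htop]
    have h1 := abs_le.1 (abs_trigSum_sub_trigSum_neg_le hτ2 hx0.le)
    have h2 := abs_le.1 (hd x)
    have h3 := abs_le.1 (hd (-x))
    rw [smoothSquareWave_neg] at h3
    have h4 : 4 * 2 * ((d : ℝ) + 1) ^ 2 * x = ε := by linarith
    rw [h4] at h1
    change 1 - ε ≤ S.toReal
    linarith
  · refine le_trans ?_ h.le
    rw [ENNReal.ofReal_le_one]
    linarith

/-- This explains the form of `c'_r`. For even `r = s + 1` the central coefficient is exactly twice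
that of row `s`; for odd `r` the ratio is smaller by the factor `1 - 1/(r+1)`. -/
lemma lowerConst_mul_gammaStar (s : ℕ) :
    lowerConst (s + 1) * gammaStar (s + 1) = 1 / (2 * s.choose (s / 2)) := by
  rcases Nat.even_or_odd' s with ⟨κ, rfl | rfl⟩
  · have h1 : ¬ Even (2 * κ + 1) := by simp
    have h2 : (2 * κ + 1) / 2 = κ := by omega
    have h3 := Nat.choose_mul_succ_eq (2 * κ) κ
    rw [show 2 * κ + 1 - κ = κ + 1 by omega] at h3
    have h4 : ((2 * κ).choose κ : ℝ) * (2 * κ + 1) = (2 * κ + 1).choose κ * (κ + 1) := by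
      exact_mod_cast h3
    have h5 : (0 : ℝ) < (2 * κ + 1).choose κ := by exact_mod_cast Nat.choose_pos (by omega)
    have h6 := centralChoose_pos κ
    rw [lowerConst, if_neg h1, gammaStar, h2, Nat.mul_div_cancel_left κ two_pos]
    push_cast
    field_simp
    linear_combination 2 * h4
  · have h1 : Even (2 * κ + 1 + 1) := ⟨κ + 1, by ring⟩
    have h2 : (2 * κ + 1) / 2 = κ := by omega
    have h3 : (2 * κ + 1 + 1) / 2 = κ + 1 := by omega
    rw [lowerConst, if_pos h1, gammaStar, h2, h3, Nat.choose_succ_succ, Nat.choose_symm_half]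
    push_cast
    ring

lemma le_stechkinConst {r : ℕ} (hr : 1 ≤ r) (n : ℕ) {δ : ℝ} (hδ : δ ≤ π / r) :
    ENNReal.ofReal (lowerConst r * gammaStar r) ≤ stechkinConst n r δ := by
  obtain ⟨s, rfl⟩ : ∃ s, r = s + 1 := ⟨r - 1, by omega⟩
  rw [lowerConst_mul_gammaStar]
  set C : ℝ := 2 * s.choose (s / 2) with hC
  have hC0 : 0 < C := by
    have : (0 : ℝ) < s.choose (s / 2) := by exact_mod_cast Nat.choose_pos (Nat.div_le_self _ _)
    positivity
  have key : ∀ ε : ℝ, 0 < ε → ε < 1 →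
      ENNReal.ofReal ((1 - ε) / C) ≤ stechkinConst n (s + 1) δ := by
    intro ε hε hε1
    obtain ⟨l, hl, hE⟩ := exists_bestApprox_smoothSquareWave_ge (n - 1) hε hε1
    refine le_trans ?_ (le_iSup₂ (f := fun f (_ : f ∈ periodicC) =>
      bestApprox (n - 1) f / modulus (s + 1) f δ) _ (smoothSquareWave_mem_periodicC l))
    rw [ENNReal.ofReal_div_of_pos hC0]
    exact ENNReal.div_le_div hE (modulus_smoothSquareWave_le hl s hδ)
  have hlim : Filter.Tendsto (fun ε : ℝ => ENNReal.ofReal ((1 - ε) / C))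
      (nhdsWithin 0 (Set.Ioi 0)) (nhds (ENNReal.ofReal (1 / C))) := by
    refine ENNReal.tendsto_ofReal ?_
    have h : Filter.Tendsto (fun ε : ℝ => (1 - ε) / C) (nhds 0) (nhds ((1 - 0) / C)) :=
      Continuous.tendsto (by fun_prop) 0
    rw [sub_zero] at h
    exact h.mono_left nhdsWithin_le_nhds
  refine le_of_tendsto hlim ?_
  filter_upwards [Ioo_mem_nhdsGT (zero_lt_one' ℝ)] with ε hε
  exact key ε hε.1 hε.2

end

theorem theorem1 (r : ℕ) (hr : 1 ≤ r) :
    (∀ n : ℕ, 1 ≤ n →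
      stechkinConst n r (2 * Real.pi / n) ≤ ENNReal.ofReal (5 * gammaStar r)) ∧
    (∀ n : ℕ, 1 ≤ n → ∀ f ∈ periodicC,
      valleePoussin ⌊(8 / 9 : ℝ) * n⌋₊ n f ∈ trigPoly (n - 1) ∧
      supNorm (fun x => f x - valleePoussin ⌊(8 / 9 : ℝ) * n⌋₊ n f x) ≤
        ENNReal.ofReal (5 * gammaStar r) * modulus r f (2 * Real.pi / n)) ∧
    (∀ n : ℕ, 1 ≤ n → ∀ δ : ℝ, 0 ≤ δ → δ ≤ Real.pi / r →
      ENNReal.ofReal (lowerConst r * gammaStar r) ≤ stechkinConst n r δ) ∧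
    (∀ n : ℕ, 2 * r ≤ n →
      ENNReal.ofReal (lowerConst r * gammaStar r) ≤
        stechkinConst n r (2 * Real.pi / n)) := by
  refine ⟨fun n hn => stechkinConst_le r hn,
    fun n hn f hf => ⟨valleePoussin_mem_trigPoly _ n f, valleePoussin_bound r hn hf⟩,
    fun n _ δ _ hδ => le_stechkinConst hr n hδ, fun n hn => le_stechkinConst hr n ?_⟩
  have hr0 : (0 : ℝ) < r := by exact_mod_cast hr
  have hn' : 2 * (r : ℝ) ≤ n := by exact_mod_cast hn
  rw [div_le_div_iff₀ (by linarith) hr0]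
  nlinarith [Real.pi_pos]
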